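/- Let $g\ge 0$ and let $\alpha_1,\dots,\alpha_g,\beta_1,\dots,\beta_g$ be real numbers with $-1<\alpha_1\le\beta_1<\alpha_2\le\beta_2<\cdots<\alpha_g\le\beta_g<1$. Put $$E=[-1,\alpha_1]\cup\bigcup_{l=1}^{g-1}[\beta_l,\alpha_{l+1}]\cup[\beta_g,1]$$ (so $E=[-1,1]$ if $g=0$) and $$w(x)=\frac1\pi\sqrt{\frac{\prod_{l=1}^g(x-\alpha_l)}{(1-x^2)\prod_{l=1}^g(x-\beta_l)}}\qquad(x\in E).$$ Let $P_n$ ($n\ge 0$) be the monic polynomial of degree $n$ with $\int_E P_nP_m\,w\,dx=0$ for $n\ne m$, and let $a_n,b_n$ ($n\ge1$) be the coefficients of their recurrence relation $xP_n(x)=P_{n+1}(x)+b_{n+1}P_n(x)+a_nP_{n-1}(x)$ for $n\ge1$, $xP_0(x)=P_1(x)+b_1P_0(x)$. Let $\mathfrak K\ge 1$ be an integer such that the recurrence coefficients have period $\mathfrak K$, that is, $b_{n+\mathfrak K}=b_n$ for all $n\ge1$ and $a_{n+\mathfrak K}=a_n$ for all $n\ge2$. Then for all integers $n,j\ge0$ and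 all $1\le i\le g$: if $P_j$ has a zero in the open gap $(\alpha_i,\beta_i)$, then $P_{n\mathfrak K+j}$ also has a zero in $(\alpha_i,\beta_i)$. -/

import Mathlib

open Polynomial MeasureTheory

noncomputable section

namespace GenCheb

/-- The set `E = [-1, α₁] ∪ [β₁, α₂] ∪ ⋯ ∪ [β_g, 1]`, written as `[-1, 1]` with the gaps
`(αᵢ, βᵢ)` removed. -/
def bands {g : ℕ} (α β : Fin g → ℝ) : Set ℝ :=
  Set.Icc (-1) 1 \ ⋃ i, Set.Ioo (α i) (β i)

/-- The weight `w(x) = (1/π) √(∏ (x - αⱼ) / ((1 - x²) ∏ (x - βⱼ)))`. -/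
def weight {g : ℕ} (α β : Fin g → ℝ) (x : ℝ) : ℝ :=
  1 / Real.pi * Real.sqrt ((∏ i, (x - α i)) / ((1 - x ^ 2) * ∏ i, (x - β i)))

/-- The inner product `∫_E p(x) q(x) w(x) dx` of two real polynomials. -/
def polyInner {g : ℕ} (α β : Fin g → ℝ) (p q : ℝ[X]) : ℝ :=
  ∫ x in bands α β, p.eval x * q.eval x * weight α β x

/-- The monic orthogonal polynomials `Pₙ` on `E` with respect to `w`, by Gram-Schmidt
orthogonalization of `1, X, X², …`. -/
def P {g : ℕ} (α β : Fin g → ℝ) (n : ℕ) : ℝ[X] :=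
  X ^ n - ∑ k : Fin n,
    C (polyInner α β (X ^ n) (P α β k) / polyInner α β (P α β k) (P α β k)) * P α β k
termination_by n
decreasing_by exact k.2

/-- The squared norms `hₙ = ∫_E Pₙ² w`. -/
def h {g : ℕ} (α β : Fin g → ℝ) (n : ℕ) : ℝ :=
  polyInner α β (P α β n) (P α β n)

/-- The coefficient `aₙ = hₙ / hₙ₋₁` (`n ≥ 1`) in the recurrence
`x Pₙ = Pₙ₊₁ + bₙ₊₁ Pₙ + aₙ Pₙ₋₁`. -/
def recA {g : ℕ} (α β : Fin g → ℝ) (n : ℕ) : ℝ :=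
  h α β n / h α β (n - 1)

/-- The coefficient `bₙ = (∫_E x Pₙ₋₁² w) / hₙ₋₁` (`n ≥ 1`) in the recurrence
`x Pₙ = Pₙ₊₁ + bₙ₊₁ Pₙ + aₙ Pₙ₋₁`. -/
def recB {g : ℕ} (α β : Fin g → ℝ) (n : ℕ) : ℝ :=
  polyInner α β (X * P α β (n - 1)) (P α β (n - 1)) / h α β (n - 1)

/-- The recurrence coefficients have period `K`: `bₙ₊K = bₙ` for `n ≥ 1`, and `aₙ₊K = aₙ` for
`n ≥ 2` (the coefficient `a₁` is exceptional and is not part of the period). -/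
def HasPeriod {g : ℕ} (α β : Fin g → ℝ) (K : ℕ) : Prop :=
  (∀ n, 1 ≤ n → recB α β (n + K) = recB α β n) ∧
    (∀ n, 2 ≤ n → recA α β (n + K) = recA α β n)

end GenCheb

end

/-! Let ψₙ(z) = ∫ Pₙ(x)/(z - x) dν be the functions of the second kind for ν = w dx, let F = ψ₀, and
let Qₙ = PₙF - ψₙ, which is a polynomial. It suffices to pass from n to n + K, and n ≥ 1 because P₀
= 1 has no zero.

The weight is chosen so that F² = N/L for z > 1, with N = ∏(z - αₖ) and L = (z² - 1)∏(z - βₖ)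
(`GenCheb.weight_integral`). By Bessel's inequality ψₙ²/hₙ → 0 off E. Under periodicity the
Casoratian of ψ with its K-shift scales like hₙ, so this decay forces it to vanish
(`casoratian_eq_zero`). Hence ψₙ₊ₖ = lψₙ (shift by K) with l² ≤ A, where A is the factor by which hₙ
grows over a period. The vanishing Casoratian is also a quadratic equation for F with polynomial
coefficients. Since F is the square root of a rational function of odd order at 1, the linear term
is zero (`quad_eq_zero`). So F² = N/L persists in the gaps, and the conjugate solution -PₙF - Qₙ is
also multiplied by a constant k, with lk = A.

In a gap (a, b), F decreases and F² → 0 at a, so F < 0. Then `shift_comparison` gives two facts: Pψ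
at index n + K is at least A times Pψ at index n, and P²F² - Q² is multiplied exactly by A. If Pₙ
vanishes at y in the gap, Pₙψₙ is positive to the left of y because it is strictly decreasing, so
the shifted product is positive there too. Near b, where F is unbounded and the shifted P does not
vanish, the shifted product P(PF - Q) has the sign of F and is negative. The shifted ψ has no zero
in the gap, so it is the shifted P that changes sign (`exists_zero_shift`). -/

/-! ### Orthogonal polynomials of an atomless measure on [-1, 1] and their recurrence. -/

/-- The pairing `∫ p q dν` of two real polynomials. -/
noncomputable def pairing (ν : Measure ℝ) (p q : ℝ[X]) : ℝ := ∫ x, p.eval x * q.eval x ∂ν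

/-- `P` is the sequence of monic orthogonal polynomials of a nonzero atomless measure `ν` which is
carried by the subset `E` of `[-1, 1]`. -/
structure IsOrthogonalSystem (ν : Measure ℝ) (E : Set ℝ) (P : ℕ → ℝ[X]) : Prop where
  carrier : ∀ᵐ x ∂ν, x ∈ E
  subset : E ⊆ Set.Icc (-1) 1
  atomless : ∀ x, ν {x} = 0
  ne_zero : ν ≠ 0
  monic : ∀ n, (P n).Monic
  natDegree : ∀ n, (P n).natDegree = n
  orth : ∀ m n, m < n → pairing ν (P n) (P m) = 0

section Pairing

lemma degree_sub_lt_of_monic {p q : ℝ[X]} {n : ℕ} (hp : p.Monic) (hq : q.Monic)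
    (hpn : p.natDegree = n) (hqn : q.natDegree = n) : (p - q).degree < (n : WithBot ℕ) := by
  have h1 := degree_eq_natDegree hp.ne_zero
  have h2 := degree_eq_natDegree hq.ne_zero
  rw [hpn] at h1
  rw [hqn] at h2
  rw [← h1]
  exact degree_sub_lt_left (h1.trans h2.symm) hp.ne_zero (by rw [hp, hq])

lemma degree_C_mul_le (c : ℝ) (p : ℝ[X]) : (C c * p).degree ≤ p.degree := by
  rw [← smul_eq_C_mul]
  exact degree_smul_le c p

variable {ν : Measure ℝ} {E : Set ℝ}

lemma integrable_eval [IsFiniteMeasure ν] (hE : ∀ᵐ x ∂ν, x ∈ E) (hs : E ⊆ Set.Icc (-1) 1)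
    (p : ℝ[X]) : Integrable (fun x => p.eval x) ν := by
  obtain ⟨C, hC⟩ := (isCompact_Icc (a := (-1 : ℝ)) (b := 1)).exists_bound_of_continuousOn
    p.continuous.continuousOn
  refine Integrable.of_bound p.continuous.aestronglyMeasurable C ?_
  filter_upwards [hE] with x hx using hC x (hs hx)

lemma pairing_comm (p q : ℝ[X]) : pairing ν p q = pairing ν q p := by
  simp only [pairing, mul_comm]

lemma pairing_mul_left (p q r : ℝ[X]) : pairing ν (p * q) r = pairing ν q (p * r) := by
  simp only [pairing, eval_mul]
  congr 1; ext x; ring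

lemma pairing_C_mul_left (c : ℝ) (p q : ℝ[X]) : pairing ν (C c * p) q = c * pairing ν p q := by
  simp only [pairing, eval_mul, eval_C, mul_assoc, integral_const_mul]

lemma pairing_zero_left (q : ℝ[X]) : pairing ν 0 q = 0 := by simp [pairing]

lemma pairing_add_left [IsFiniteMeasure ν] (hE : ∀ᵐ x ∂ν, x ∈ E) (hs : E ⊆ Set.Icc (-1) 1)
    (p q r : ℝ[X]) : pairing ν (p + q) r = pairing ν p r + pairing ν q r := by
  have h1 := integrable_eval hE hs (p * r)
  have h2 := integrable_eval hE hs (q * r)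
  simp only [eval_mul] at h1 h2
  simp only [pairing, eval_add, add_mul]
  exact integral_add h1 h2

lemma pairing_sub_left [IsFiniteMeasure ν] (hE : ∀ᵐ x ∂ν, x ∈ E) (hs : E ⊆ Set.Icc (-1) 1)
    (p q r : ℝ[X]) : pairing ν (p - q) r = pairing ν p r - pairing ν q r := by
  have h1 := integrable_eval hE hs (p * r)
  have h2 := integrable_eval hE hs (q * r)
  simp only [eval_mul] at h1 h2
  simp only [pairing, eval_sub, sub_mul]
  exact integral_sub h1 h2

lemma pairing_sum_left [IsFiniteMeasure ν] (hE : ∀ᵐ x ∂ν, x ∈ E) (hs : E ⊆ Set.Icc (-1) 1)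
    {ι : Type*} (s : Finset ι) (p : ι → ℝ[X]) (r : ℝ[X]) :
    pairing ν (∑ i ∈ s, p i) r = ∑ i ∈ s, pairing ν (p i) r := by
  classical
  induction s using Finset.induction_on with
  | empty => simp [pairing_zero_left]
  | insert a s ha ih => rw [Finset.sum_insert ha, Finset.sum_insert ha, pairing_add_left hE hs, ih]

/-- A nonnegative function whose zeros are zeros of a nonzero polynomial has positive integral
against a nonzero atomless measure. -/
lemma integral_pos_of_zeros (hν : ν ≠ 0) (hat : ∀ x, ν {x} = 0) {f : ℝ → ℝ}
    (hf : Integrable f ν) (h0 : ∀ᵐ x ∂ν, 0 ≤ f x) {p : ℝ[X]} (hp : p ≠ 0)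
    (hz : ∀ᵐ x ∂ν, f x = 0 → p.eval x = 0) : 0 < ∫ x, f x ∂ν := by
  refine lt_of_le_of_ne (integral_nonneg_of_ae h0) fun h => hν ?_
  have h1 := (integral_eq_zero_iff_of_nonneg_ae h0 hf).1 h.symm
  have h2 : ν {x | p.eval x = 0} = 0 := by
    have hfin : {x | p.eval x = 0}.Finite := by
      refine (p.roots.toFinset.finite_toSet).subset fun x hx => ?_
      simpa [hp] using hx
    have := NullSingletonClass.mk (μ := ν) hat
    exact hfin.measure_zero ν
  have h3 : ∀ᵐ x ∂ν, p.eval x ≠ 0 := by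
    simpa [ae_iff] using h2
  have h4 : ∀ᵐ x ∂ν, False := by
    filter_upwards [h1, h3, hz] with x hx1 hx3 hx
    exact hx3 (hx hx1)
  simpa using h4

lemma pairing_self_pos_of_ne_zero [IsFiniteMeasure ν] (hE : ∀ᵐ x ∂ν, x ∈ E)
    (hs : E ⊆ Set.Icc (-1) 1) (hν : ν ≠ 0) (hat : ∀ x, ν {x} = 0) {p : ℝ[X]} (hp : p ≠ 0) :
    0 < pairing ν p p := by
  have h := integrable_eval hE hs (p * p)
  simp only [eval_mul] at h
  exact integral_pos_of_zeros hν hat h (.of_forall fun x => mul_self_nonneg _) hp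
    (.of_forall fun x => by simp)

end Pairing

namespace IsOrthogonalSystem

variable {ν : Measure ℝ} {E : Set ℝ} {P : ℕ → ℝ[X]}

lemma degree_eq (H : IsOrthogonalSystem ν E P) (n : ℕ) : (P n).degree = n := by
  rw [degree_eq_natDegree (H.monic n).ne_zero, H.natDegree]

/-- Orthogonality to `P 0, …, P (d - 1)` is orthogonality to all polynomials of degree `< d`. -/
lemma degree_X_mul_sub_lt (H : IsOrthogonalSystem ν E P) (n : ℕ) :
    (X * P n - P (n + 1)).degree < ((n + 1 : ℕ) : WithBot ℕ) :=
  degree_sub_lt_of_monic (monic_X.mul (H.monic n)) (H.monic _)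
    (by rw [natDegree_X_mul (H.monic n).ne_zero, H.natDegree]) (H.natDegree _)

lemma apply_zero (H : IsOrthogonalSystem ν E P) : P 0 = 1 :=
  (H.monic 0).natDegree_eq_zero.1 (H.natDegree 0)

variable [IsFiniteMeasure ν]

lemma pairing_self_pos (H : IsOrthogonalSystem ν E P) {p : ℝ[X]} (hp : p ≠ 0) :
    0 < pairing ν p p :=
  pairing_self_pos_of_ne_zero H.carrier H.subset H.ne_zero H.atomless hp

lemma norm_pos (H : IsOrthogonalSystem ν E P) (n : ℕ) : 0 < pairing ν (P n) (P n) :=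
  H.pairing_self_pos (H.monic n).ne_zero

/-- The `P k` with k < d span the polynomials of degree below d; the induction peels off the leading
term of `q`. -/
lemma pairing_eq_zero_of_forall (H : IsOrthogonalSystem ν E P) (f : ℝ[X]) (d : ℕ)
    (hf : ∀ k < d, pairing ν f (P k) = 0) (q : ℝ[X]) (hq : q.degree < d) :
    pairing ν f q = 0 := by
  induction d generalizing q with
  | zero =>
    have : q = 0 := by simpa using hq
    rw [this, pairing_comm, pairing_zero_left]
  | succ d ih =>
    have h1 : (q - C (q.coeff d) * P d).degree < d := by
      rw [degree_lt_iff_coeff_zero]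
      intro m hm
      rcases hm.eq_or_lt with rfl | hm
      · have : (P d).coeff d = 1 := by
          have := (H.monic d).coeff_natDegree
          rwa [H.natDegree] at this
        simp [this]
      · have h2 : q.coeff m = 0 := (degree_lt_iff_coeff_zero _ _).1 hq m hm
        have h3 : (P d).coeff m = 0 := coeff_eq_zero_of_natDegree_lt (by rwa [H.natDegree])
        simp [h2, h3]
    have h2 := ih (fun k hk => hf k (by omega)) _ h1
    rw [pairing_comm, pairing_sub_left H.carrier H.subset, pairing_C_mul_left,
      pairing_comm (P d) f, hf d (by omega), pairing_comm q] at h2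
    linarith

lemma pairing_eq_zero (H : IsOrthogonalSystem ν E P) (n : ℕ) (q : ℝ[X]) (hq : q.degree < n) :
    pairing ν (P n) q = 0 :=
  H.pairing_eq_zero_of_forall _ n (fun k hk => H.orth k n hk) q hq

lemma eq_zero_of_pairing (H : IsOrthogonalSystem ν E P) (d : ℕ) (f : ℝ[X]) (hd : f.degree < d)
    (hf : ∀ k < d, pairing ν f (P k) = 0) : f = 0 := by
  by_contra h
  exact (H.pairing_self_pos h).ne' (H.pairing_eq_zero_of_forall f d hf f hd)

lemma pairing_of_monic (H : IsOrthogonalSystem ν E P) (n : ℕ) (q : ℝ[X]) (hq : q.Monic)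
    (hd : q.natDegree = n) : pairing ν (P n) q = pairing ν (P n) (P n) := by
  have h1 := degree_sub_lt_of_monic hq (H.monic n) hd (H.natDegree n)
  have h2 := H.pairing_eq_zero n _ h1
  rw [pairing_comm, pairing_sub_left H.carrier H.subset, pairing_comm q] at h2
  linarith

lemma apply_one (H : IsOrthogonalSystem ν E P) :
    P 1 = X - C (pairing ν (X * P 0) (P 0) / pairing ν (P 0) (P 0)) := by
  set b := pairing ν (X * P 0) (P 0) / pairing ν (P 0) (P 0) with hb
  have h0 := H.norm_pos 0
  suffices h : X * P 0 - P 1 - C b * P 0 = 0 by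
    rw [H.apply_zero] at h
    linear_combination -h
  apply H.eq_zero_of_pairing 1
  · refine (degree_sub_le _ _).trans_lt (max_lt (H.degree_X_mul_sub_lt 0) ?_)
    exact (degree_C_mul_le _ _).trans_lt (by rw [H.degree_eq]; norm_num)
  · intro k hk
    obtain rfl : k = 0 := by omega
    simp only [pairing_sub_left H.carrier H.subset, pairing_C_mul_left]
    rw [H.orth 0 1 hk, hb]
    field_simp; ring

lemma recurrence (H : IsOrthogonalSystem ν E P) (n : ℕ) :
    P (n + 2) = (X - C (pairing ν (X * P (n + 1)) (P (n + 1)) / pairing ν (P (n + 1)) (P (n + 1))))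
      * P (n + 1) - C (pairing ν (P (n + 1)) (P (n + 1)) / pairing ν (P n) (P n)) * P n := by
  set b := pairing ν (X * P (n + 1)) (P (n + 1)) / pairing ν (P (n + 1)) (P (n + 1)) with hb
  set a := pairing ν (P (n + 1)) (P (n + 1)) / pairing ν (P n) (P n) with ha
  have h0 := H.norm_pos n
  have h1 := H.norm_pos (n + 1)
  suffices h : X * P (n + 1) - P (n + 2) - C b * P (n + 1) - C a * P n = 0 by
    linear_combination -h
  apply H.eq_zero_of_pairing (n + 2)
  · refine (degree_sub_le _ _).trans_lt (max_lt ((degree_sub_le _ _).trans_lt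
      (max_lt (H.degree_X_mul_sub_lt (n + 1)) ?_)) ?_)
    · exact (degree_C_mul_le _ _).trans_lt (by rw [H.degree_eq]; norm_cast; omega)
    · exact (degree_C_mul_le _ _).trans_lt (by rw [H.degree_eq]; norm_cast; omega)
  · intro k hk
    simp only [pairing_sub_left H.carrier H.subset, pairing_C_mul_left, pairing_mul_left X]
    rw [H.orth k (n + 2) hk]
    rcases Nat.lt_succ_iff_lt_or_eq.1 hk with hk' | rfl
    · rw [H.orth k (n+1) hk']
      rcases Nat.lt_succ_iff_lt_or_eq.1 hk' with hk2 | rfl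
      · rw [H.orth k n hk2, H.pairing_eq_zero]
        · ring
        · rw [degree_mul, degree_X, H.degree_eq]
          norm_cast; omega
      · rw [H.pairing_of_monic (k + 1) (X * P k) (monic_X.mul (H.monic k))
          (by rw [natDegree_X_mul (H.monic k).ne_zero, H.natDegree]), ha]
        field_simp; ring
    · rw [pairing_comm (P n), H.orth n (n+1) (by omega), ← pairing_mul_left, hb]
      field_simp; ring

end IsOrthogonalSystem

/-! ### Functions of the second kind off the support. -/

/-- The point `z` has positive distance from `E`. -/
def IsAway (E : Set ℝ) (z : ℝ) : Prop := ∃ δ > 0, ∀ x ∈ E, δ ≤ |z - x|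

/-- The function of the second kind `∫ p(x) / (z - x) dν(x)`. -/
noncomputable def cauchyTransform (ν : Measure ℝ) (p : ℝ[X]) (z : ℝ) : ℝ :=
  ∫ x, p.eval x * (z - x)⁻¹ ∂ν

section Cauchy

variable {ν : Measure ℝ} {E : Set ℝ}

lemma integrable_mul_inv {z : ℝ} (hE : ∀ᵐ x ∂ν, x ∈ E) (hz : IsAway E z) {f : ℝ → ℝ}
    (hf : Integrable f ν) : Integrable (fun x => f x * (z - x)⁻¹) ν := by
  obtain ⟨δ, hδ, h⟩ := hz
  refine hf.mul_bdd (c := δ⁻¹) (by fun_prop) ?_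
  filter_upwards [hE] with x hx
  rw [norm_inv, Real.norm_eq_abs]
  exact inv_anti₀ hδ (h x hx)

lemma IsAway.sub_ne_zero {z x : ℝ} (hz : IsAway E z) (hx : x ∈ E) : z - x ≠ 0 := by
  obtain ⟨δ, hδ, h⟩ := hz
  exact abs_pos.1 (hδ.trans_le (h x hx))

lemma cauchy_C_mul (c : ℝ) (p : ℝ[X]) (z : ℝ) :
    cauchyTransform ν (C c * p) z = c * cauchyTransform ν p z := by
  simp only [cauchyTransform, eval_mul, eval_C, mul_assoc, integral_const_mul]

end Cauchy

namespace IsOrthogonalSystem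

variable {ν : Measure ℝ} {E : Set ℝ} {P : ℕ → ℝ[X]} [IsFiniteMeasure ν]

lemma integrable_cauchy (H : IsOrthogonalSystem ν E P) {z : ℝ} (hz : IsAway E z) (p : ℝ[X]) :
    Integrable (fun x => p.eval x * (z - x)⁻¹) ν :=
  integrable_mul_inv H.carrier hz (integrable_eval H.carrier H.subset p)

lemma cauchy_sub (H : IsOrthogonalSystem ν E P) {z : ℝ} (hz : IsAway E z) (p q : ℝ[X]) :
    cauchyTransform ν (p - q) z = cauchyTransform ν p z - cauchyTransform ν q z := by
  simp only [cauchyTransform, eval_sub, sub_mul]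
  exact integral_sub (H.integrable_cauchy hz p) (H.integrable_cauchy hz q)

lemma cauchy_X_mul (H : IsOrthogonalSystem ν E P) {z : ℝ} (hz : IsAway E z) (p : ℝ[X]) :
    cauchyTransform ν (X * p) z = z * cauchyTransform ν p z - pairing ν p 1 := by
  have h1 := integrable_eval H.carrier H.subset p
  have h2 := (H.integrable_cauchy hz p).const_mul z
  simp only [cauchyTransform, pairing, ← integral_const_mul, eval_one, mul_one]
  rw [← integral_sub h2 h1]
  apply integral_congr_ae
  filter_upwards [H.carrier] with x hx
  have := hz.sub_ne_zero hx
  simp only [eval_mul, eval_X]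
  field_simp
  ring

lemma cauchy_one (H : IsOrthogonalSystem ν E P) {z : ℝ} (hz : IsAway E z) :
    cauchyTransform ν (P 1) z = (z - pairing ν (X * P 0) (P 0) / pairing ν (P 0) (P 0)) *
      cauchyTransform ν (P 0) z - pairing ν (P 0) (P 0) := by
  have : P 1 = X * P 0 - C (pairing ν (X * P 0) (P 0) / pairing ν (P 0) (P 0)) * P 0 := by
    rw [H.apply_one, H.apply_zero]; ring
  rw [this, H.cauchy_sub hz, cauchy_C_mul, H.cauchy_X_mul hz]
  nth_rw 5 [H.apply_zero]
  nth_rw 7 [H.apply_zero]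
  rw [H.apply_zero]
  ring

lemma cauchy_add_two (H : IsOrthogonalSystem ν E P) {z : ℝ} (hz : IsAway E z) (n : ℕ) :
    cauchyTransform ν (P (n + 2)) z =
      (z - pairing ν (X * P (n + 1)) (P (n + 1)) / pairing ν (P (n + 1)) (P (n + 1))) *
      cauchyTransform ν (P (n + 1)) z -
      pairing ν (P (n + 1)) (P (n + 1)) / pairing ν (P n) (P n) * cauchyTransform ν (P n) z := by
  have h0 : pairing ν (P (n + 1)) 1 = 0 := by
    have := H.orth 0 (n + 1) (by omega)
    rwa [H.apply_zero] at this
  rw [H.recurrence n, sub_mul, H.cauchy_sub hz, H.cauchy_sub hz, cauchy_C_mul, cauchy_C_mul,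
    H.cauchy_X_mul hz, h0]
  ring

/-- `Pₙ(z) ψₙ(z) = ∫ Pₙ² / (z - x) dν`. -/
lemma eval_mul_cauchy (H : IsOrthogonalSystem ν E P) {z : ℝ} (hz : IsAway E z) (n : ℕ) :
    (P n).eval z * cauchyTransform ν (P n) z = ∫ x, (P n).eval x ^ 2 * (z - x)⁻¹ ∂ν := by
  -- Pₙ(z) = Pₙ(x) + (z - x)R(x) with deg R < n, so the extra term Pₙ(x)R(x) integrates to zero by
  -- orthogonality.
  set R := (P n - C ((P n).eval z)) /ₘ (X - C z) with hR
  have hR1 : (X - C z) * R = P n - C ((P n).eval z) :=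
    mul_divByMonic_eq_iff_isRoot.2 (by simp [IsRoot])
  have hR2 : pairing ν (P n) R = 0 := by
    by_cases hR0 : R = 0
    · rw [hR0, pairing_comm, pairing_zero_left]
    apply H.pairing_eq_zero
    have h1 : (P n - C ((P n).eval z)).degree ≤ n := by
      refine (degree_sub_le _ _).trans (max_le (H.degree_eq n).le (degree_C_le.trans ?_))
      exact_mod_cast Nat.zero_le n
    rw [← hR1, degree_mul, degree_X_sub_C, degree_eq_natDegree hR0] at h1
    rw [degree_eq_natDegree hR0]
    norm_cast at h1 ⊢
    omega
  have h3 := H.integrable_cauchy hz (P n * P n)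
  have h4 := integrable_eval H.carrier H.subset (P n * R)
  simp only [eval_mul] at h3 h4
  have h5 : (P n).eval z * cauchyTransform ν (P n) z =
      ∫ x, ((P n).eval x * (P n).eval x * (z - x)⁻¹ + (P n).eval x * R.eval x) ∂ν := by
    rw [cauchyTransform, ← integral_const_mul]
    apply integral_congr_ae
    filter_upwards [H.carrier] with x hx
    have := hz.sub_ne_zero hx
    have h6 := congrArg (eval x) hR1
    simp only [eval_mul, eval_sub, eval_X, eval_C] at h6
    have h7 : (P n).eval z = (P n).eval x + (z - x) * R.eval x := by linear_combination h6
    rw [h7]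
    field_simp
  rw [h5, integral_add h3 h4]
  have : ∫ x, (P n).eval x * R.eval x ∂ν = 0 := hR2
  rw [this, add_zero]
  simp only [sq]

/-- The Wronskian of `Pₙ` and `ψₙ`. -/
lemma wronskian (H : IsOrthogonalSystem ν E P) {z : ℝ} (hz : IsAway E z) (n : ℕ) :
    (P (n + 1)).eval z * cauchyTransform ν (P n) z -
      (P n).eval z * cauchyTransform ν (P (n + 1)) z = pairing ν (P n) (P n) := by
  induction n with
  | zero =>
    rw [H.cauchy_one hz, H.apply_one]
    simp [H.apply_zero]
  | succ n ih =>
    have h0 := (H.norm_pos n).ne'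
    rw [H.cauchy_add_two hz, H.recurrence n]
    simp only [eval_sub, eval_mul, eval_X, eval_C]
    field_simp
    linear_combination pairing ν (P (n + 1)) (P (n + 1)) * ih

/-- Bessel's inequality for `1 / (z - x)`. -/
lemma bessel (H : IsOrthogonalSystem ν E P) {z : ℝ} (hz : IsAway E z) (N : ℕ) :
    ∑ m ∈ Finset.range N, cauchyTransform ν (P m) z ^ 2 / pairing ν (P m) (P m) ≤
      ∫ x, (z - x)⁻¹ * (z - x)⁻¹ ∂ν := by
  set S : ℝ[X] := ∑ m ∈ Finset.range N,
    C (cauchyTransform ν (P m) z / pairing ν (P m) (P m)) * P m with hS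
  have h1 : pairing ν S S = ∑ m ∈ Finset.range N,
      cauchyTransform ν (P m) z ^ 2 / pairing ν (P m) (P m) := by
    nth_rw 1 [hS]
    rw [pairing_sum_left H.carrier H.subset]
    refine Finset.sum_congr rfl fun m hm => ?_
    rw [pairing_C_mul_left, pairing_comm (P m) S, hS, pairing_sum_left H.carrier H.subset,
      Finset.sum_eq_single m]
    · have := (H.norm_pos m).ne'
      rw [pairing_C_mul_left]
      field_simp
    · intro k _ hk
      rw [pairing_C_mul_left]
      rcases hk.lt_or_gt with hk | hk
      · rw [pairing_comm (P k) (P m), H.orth k m hk, mul_zero]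
      · rw [H.orth m k hk, mul_zero]
    · intro h; exact absurd hm h
  have h2 : ∫ x, S.eval x * (z - x)⁻¹ ∂ν = ∑ m ∈ Finset.range N,
      cauchyTransform ν (P m) z ^ 2 / pairing ν (P m) (P m) := by
    simp only [hS, eval_finsetSum, Finset.sum_mul]
    rw [integral_finsetSum _ fun m _ => H.integrable_cauchy hz _]
    refine Finset.sum_congr rfl fun m _ => ?_
    change cauchyTransform ν _ z = _
    rw [cauchy_C_mul]
    ring
  have i1 : Integrable (fun x => (z - x)⁻¹ * (z - x)⁻¹) ν :=
    integrable_mul_inv H.carrier hz (by simpa using H.integrable_cauchy hz 1)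
  have i2 := H.integrable_cauchy hz S
  have i3 := integrable_eval H.carrier H.subset (S * S)
  simp only [eval_mul] at i3
  -- The integrand is the square of 1/(z - x) - S(x), where S is the N-th Fourier sum of 1/(z - x).
  have h3 : 0 ≤ ∫ x, ((z - x)⁻¹ * (z - x)⁻¹ - 2 * (S.eval x * (z - x)⁻¹) +
      S.eval x * S.eval x) ∂ν :=
    integral_nonneg fun x => by
      have := sq_nonneg ((z - x)⁻¹ - S.eval x)
      change 0 ≤ _
      nlinarith
  have i4 : Integrable (fun x => (z - x)⁻¹ * (z - x)⁻¹ - 2 * (S.eval x * (z - x)⁻¹)) ν :=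
    i1.sub (i2.const_mul 2)
  rw [integral_add i4 i3, integral_sub i1 (i2.const_mul 2), integral_const_mul, h2] at h3
  have h4 : ∫ x, S.eval x * S.eval x ∂ν = _ := h1
  rw [h4] at h3
  linarith

lemma tendsto_cauchy_sq_div (H : IsOrthogonalSystem ν E P) {z : ℝ} (hz : IsAway E z) :
    Filter.Tendsto (fun m => cauchyTransform ν (P m) z ^ 2 / pairing ν (P m) (P m))
      Filter.atTop (nhds 0) :=
  (summable_of_sum_range_le (fun m => div_nonneg (sq_nonneg _) (H.norm_pos m).le)
    (H.bessel hz)).tendsto_atTop_zero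

end IsOrthogonalSystem

/-! ### A logarithmic integral. -/

lemma hasDerivAt_log_primitive {s t : ℝ} (ht : 0 < t) :
    HasDerivAt (fun t => t * Real.log (1 + t ^ 2) - t * Real.log (s ^ 2 + t ^ 2) +
      2 * Real.arctan t - 2 * (s * Real.arctan (t / s)))
      (Real.log ((1 + t ^ 2) / (s ^ 2 + t ^ 2))) t := by
  have h1 : (1 + t ^ 2) ≠ 0 := by positivity
  have h2 : (s ^ 2 + t ^ 2) ≠ 0 := by positivity
  have d1 : HasDerivAt (fun t : ℝ => 1 + t ^ 2) (2 * t) t := by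
    simpa using (hasDerivAt_pow 2 t).const_add 1
  have d2 : HasDerivAt (fun t : ℝ => s ^ 2 + t ^ 2) (2 * t) t := by
    simpa using (hasDerivAt_pow 2 t).const_add (s ^ 2)
  have d3 : HasDerivAt (fun t : ℝ => s * Real.arctan (t / s)) (s ^ 2 / (s ^ 2 + t ^ 2)) t := by
    -- The case s = 0 is needed for the total mass of the weight; there t / s = 0 and the last term
    -- of the primitive drops out.
    rcases eq_or_ne s 0 with rfl | hs
    · simpa using hasDerivAt_const t (0 : ℝ)
    · refine ((((hasDerivAt_id t).div_const s).arctan).const_mul s).congr_deriv ?_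
      simp only [id]
      field_simp
  refine (((((hasDerivAt_id t).mul (d1.log h1)).sub ((hasDerivAt_id t).mul (d2.log h2))).add
    ((Real.hasDerivAt_arctan t).const_mul 2)).sub (d3.const_mul 2)).congr_deriv ?_
  rw [Real.log_div h1 h2]
  simp only [id]
  field_simp
  ring

lemma continuous_log_primitive (s : ℝ) :
    Continuous (fun t => t * Real.log (1 + t ^ 2) - t * Real.log (s ^ 2 + t ^ 2) +
      2 * Real.arctan t - 2 * (s * Real.arctan (t / s))) := by
  have h1 : Continuous fun t : ℝ => Real.log (1 + t ^ 2) :=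
    Continuous.log (by fun_prop) fun t => by positivity
  have h2 : Continuous fun t : ℝ => t * Real.log (s ^ 2 + t ^ 2) := by
    rcases eq_or_ne s 0 with rfl | hs
    · convert Real.continuous_mul_log.const_mul 2 using 2 with t
      rw [zero_pow two_ne_zero, zero_add, Real.log_pow]
      push_cast; ring
    · exact continuous_id.mul (Continuous.log (by fun_prop) fun t => by positivity)
  have h3 : Continuous fun t : ℝ => Real.arctan (t / s) :=
    Real.continuous_arctan.comp (by fun_prop)
  have h4 := Real.continuous_arctan
  fun_prop

lemma tendsto_log_primitive {s : ℝ} (hs0 : 0 ≤ s) (hs1 : s ≤ 1) :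
    Filter.Tendsto (fun t => t * Real.log (1 + t ^ 2) - t * Real.log (s ^ 2 + t ^ 2) +
      2 * Real.arctan t - 2 * (s * Real.arctan (t / s))) Filter.atTop
      (nhds (Real.pi * (1 - s))) := by
  have h1 : Filter.Tendsto (fun t => t * Real.log (1 + t ^ 2) - t * Real.log (s ^ 2 + t ^ 2))
      Filter.atTop (nhds 0) := by
    refine tendsto_of_tendsto_of_tendsto_of_le_of_le' tendsto_const_nhds
      tendsto_inv_atTop_zero ?_ ?_
    · filter_upwards [Filter.eventually_gt_atTop 0] with t ht
      rw [← mul_sub]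
      refine mul_nonneg ht.le (sub_nonneg.2 (Real.log_le_log (by positivity) ?_))
      nlinarith
    · filter_upwards [Filter.eventually_gt_atTop 0] with t ht
      have h2 : (s ^ 2 + t ^ 2) ≠ 0 := by positivity
      rw [← mul_sub, ← Real.log_div (by positivity) h2]
      have h3 := Real.log_le_sub_one_of_pos (x := (1 + t ^ 2) / (s ^ 2 + t ^ 2)) (by positivity)
      have h4 : (1 + t ^ 2) / (s ^ 2 + t ^ 2) - 1 ≤ 1 / t ^ 2 := by
        rw [div_sub_one h2, div_le_div_iff₀ (by positivity) (by positivity)]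
        nlinarith [mul_nonneg (sq_nonneg s) (sq_nonneg t), sq_nonneg s]
      calc t * _ ≤ t * (1 / t ^ 2) := mul_le_mul_of_nonneg_left (h3.trans h4) ht.le
        _ = t⁻¹ := by field_simp
  have h5 : Filter.Tendsto Real.arctan Filter.atTop (nhds (Real.pi / 2)) :=
    Real.tendsto_arctan_atTop.mono_right nhdsWithin_le_nhds
  have h6 : Filter.Tendsto (fun t => s * Real.arctan (t / s)) Filter.atTop
      (nhds (s * (Real.pi / 2))) := by
    rcases hs0.eq_or_lt with rfl | hs
    · simp
    · exact (h5.comp (Filter.tendsto_id.atTop_div_const hs)).const_mul s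
  convert (h1.add (h5.const_mul 2)).sub (h6.const_mul 2) using 2
  ring

/-- The primitive vanishes at 0 and tends to π(1 - s) at infinity. This is the outer integral in the
layer-cake computation of the Stieltjes transform, with s² the value of the interlacing quotient at
z. -/
lemma lintegral_log_div {s : ℝ} (hs0 : 0 ≤ s) (hs1 : s ≤ 1) :
    ∫⁻ t in Set.Ioi (0 : ℝ), ENNReal.ofReal (Real.log ((1 + t ^ 2) / (s ^ 2 + t ^ 2))) =
      ENNReal.ofReal (Real.pi * (1 - s)) := by
  have hc := (continuous_log_primitive s).continuousWithinAt (s := Set.Ici 0) (x := 0)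
  have hd : ∀ t ∈ Set.Ioi (0 : ℝ), HasDerivAt _ _ t := fun t ht =>
    hasDerivAt_log_primitive (s := s) ht
  have h0 : ∀ t ∈ Set.Ioi (0 : ℝ), 0 ≤ Real.log ((1 + t ^ 2) / (s ^ 2 + t ^ 2)) := by
    intro t ht
    have ht : 0 < t := ht
    apply Real.log_nonneg
    rw [one_le_div (by positivity)]
    nlinarith
  have hl := tendsto_log_primitive hs0 hs1
  rw [← ofReal_integral_eq_lintegral_ofReal (integrableOn_Ioi_deriv_of_nonneg hc hd h0 hl)
    ((ae_restrict_iff' measurableSet_Ioi).2 (.of_forall h0)),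
    integral_Ioi_of_hasDerivAt_of_nonneg hc hd h0 hl]
  simp

lemma exists_zero_of_mul_neg {f : ℝ → ℝ} {a b : ℝ} (hab : a ≤ b) (hf : ContinuousOn f (Set.Icc a b))
    (h : f a * f b < 0) : ∃ x ∈ Set.Ioo a b, f x = 0 := by
  rcases mul_neg_iff.1 h with ⟨ha, hb⟩ | ⟨ha, hb⟩
  · obtain ⟨x, hx, hx0⟩ := intermediate_value_Ioo' hab hf ⟨hb, ha⟩
    exact ⟨x, hx, hx0⟩
  · obtain ⟨x, hx, hx0⟩ := intermediate_value_Ioo hab hf ⟨ha, hb⟩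
    exact ⟨x, hx, hx0⟩

/-! ### Layer-cake integration of the root of an interlacing quotient. -/

section Bands

variable {m : ℕ} {p q : Fin m → ℝ}

/-- The left side has degree m and leading coefficient 1 + u, and it changes sign on each of the m
disjoint intervals: in the product of its values at `p k` and `q k`, only the factor j = k is
negative. So it has m distinct roots and factors completely. -/
lemma exists_interlacing_roots (hpq : ∀ k, p k < q k) (hsep : ∀ j k, j < k → q j < p k) {u : ℝ}
    (hu : 0 < u) : ∃ x : Fin m → ℝ, (∀ k, x k ∈ Set.Ioo (p k) (q k)) ∧
      ∀ y, ∏ k, (y - q k) + u * ∏ k, (y - p k) = (1 + u) * ∏ k, (y - x k) := by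
  have key : ∀ k, ∃ x ∈ Set.Ioo (p k) (q k), ∏ j, (x - q j) + u * ∏ j, (x - p j) = 0 := by
    intro k
    set f : ℝ → ℝ := fun x => ∏ j, (x - q j) + u * ∏ j, (x - p j) with hf
    have hfc : Continuous f := by fun_prop
    have h1 : f (p k) * f (q k) < 0 := by
      have e1 : f (p k) = ∏ j, (p k - q j) := by
        simp only [hf]
        rw [Finset.prod_eq_zero (Finset.mem_univ k) (f := fun j => p k - p j) (sub_self _)]
        ring
      have e2 : f (q k) = u * ∏ j, (q k - p j) := by
        simp only [hf]
        rw [Finset.prod_eq_zero (Finset.mem_univ k) (f := fun j => q k - q j) (sub_self _)]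
        ring
      have e3 : f (p k) * f (q k) = u * ∏ j, ((p k - q j) * (q k - p j)) := by
        rw [e1, e2, Finset.prod_mul_distrib]; ring
      rw [e3, ← Finset.mul_prod_erase _ _ (Finset.mem_univ k)]
      have e4 : 0 < ∏ j ∈ Finset.univ.erase k, ((p k - q j) * (q k - p j)) := by
        refine Finset.prod_pos fun j hj => ?_
        have hk := hpq k
        have hj' := hpq j
        rcases (Finset.ne_of_mem_erase hj).lt_or_gt with h | h
        · have := hsep j k h
          exact mul_pos (by linarith) (by linarith)
        · have := hsep k j h
          exact mul_pos_of_neg_of_neg (by linarith) (by linarith)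
      have e5 : (p k - q k) * (q k - p k) < 0 :=
        mul_neg_of_neg_of_pos (by linarith [hpq k]) (by linarith [hpq k])
      exact mul_neg_of_pos_of_neg hu (mul_neg_of_neg_of_pos e5 e4)
    obtain ⟨x, hx, hx0⟩ := exists_zero_of_mul_neg (hpq k).le hfc.continuousOn h1
    exact ⟨x, hx, hx0⟩
  choose x hx hx0 using key
  refine ⟨x, hx, fun y => ?_⟩
  have hmono : StrictMono x := fun j k hjk => (hx j).2.trans ((hsep j k hjk).trans (hx k).1)
  have hM : ∀ a : Fin m → ℝ, (∏ k, (X - C (a k))).Monic ∧ (∏ k, (X - C (a k))).natDegree = m :=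
    fun a => ⟨monic_prod_of_monic _ _ fun k _ => monic_X_sub_C _, by
      rw [natDegree_prod_of_monic _ _ fun k _ => monic_X_sub_C _]; simp⟩
  -- Differences of monic polynomials of degree m have degree below m, so vanishing at the m points
  -- `x k` suffices.
  have hz : (∏ k, (X - C (q k)) - ∏ k, (X - C (x k))) +
      C u * (∏ k, (X - C (p k)) - ∏ k, (X - C (x k))) = 0 := by
    refine eq_zero_of_degree_lt_of_eval_index_eq_zero (s := Finset.univ) (v := x)
      hmono.injective.injOn ?_ ?_
    · refine (degree_add_le _ _).trans_lt (max_lt ?_ ((degree_C_mul_le _ _).trans_lt ?_))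
      · simpa using degree_sub_lt_of_monic (hM q).1 (hM x).1 (hM q).2 (hM x).2
      · simpa using degree_sub_lt_of_monic (hM p).1 (hM x).1 (hM p).2 (hM x).2
    · intro k _
      have e : ∏ j, (x k - x j) = 0 := Finset.prod_eq_zero (Finset.mem_univ k) (sub_self _)
      simp only [eval_add, eval_sub, eval_mul, eval_C, eval_prod, eval_X, e]
      linarith [hx0 k]
  have := congrArg (eval y) hz
  simp only [eval_add, eval_sub, eval_mul, eval_C, eval_prod, eval_X, eval_zero] at this
  linarith

/-- The interlacing quotient `∏ (x - qₖ) / (x - pₖ)`. -/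
noncomputable def interlacingQuotient (p q : Fin m → ℝ) (x : ℝ) : ℝ := ∏ k, (x - q k) / (x - p k)

lemma lintegral_inv_sub {a b z : ℝ} (hab : a < b) (hbz : b < z) :
    ∫⁻ x in Set.Ioo a b, ENNReal.ofReal (z - x)⁻¹ =
      ENNReal.ofReal (Real.log ((z - a) / (z - b))) := by
  have h0 : ∀ x ∈ Set.Icc a b, 0 < z - x := fun x hx => by linarith [hx.2]
  have hc : ContinuousOn (fun x => (z - x)⁻¹) (Set.Icc a b) :=
    ContinuousOn.inv₀ (by fun_prop) fun x hx => (h0 x hx).ne'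
  have hd : ∀ x ∈ Set.uIcc a b, HasDerivAt (fun x => -Real.log (z - x)) (z - x)⁻¹ x := by
    intro x hx
    rw [Set.uIcc_of_le hab.le] at hx
    refine ((((hasDerivAt_id x).const_sub z).log (h0 x hx).ne').neg).congr_deriv ?_
    simp [neg_div]
  have hi : IntervalIntegrable (fun x => (z - x)⁻¹) volume a b :=
    ContinuousOn.intervalIntegrable (by rwa [Set.uIcc_of_le hab.le])
  rw [← ofReal_integral_eq_lintegral_ofReal (hc.integrableOn_Icc.mono_set Set.Ioo_subset_Icc_self)
    ((ae_restrict_iff' measurableSet_Ioo).2 (.of_forall fun x hx =>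
      (inv_pos.2 (h0 x (Set.Ioo_subset_Icc_self hx))).le)), ← integral_Ioc_eq_integral_Ioo,
    ← intervalIntegral.integral_of_le hab.le, intervalIntegral.integral_eq_sub_of_hasDerivAt hd hi,
    Real.log_div (by linarith) (by linarith)]
  congr 1
  ring

/-- Writing r for the quotient, r + t² = (1 + t²)∏(y - xⱼ)/(y - pⱼ). On the k-th interval all
factors with j ≠ k are positive, as is y - pₖ, so the sign is that of y - xₖ. -/
lemma lt_sqrt_interlacingQuotient_iff (hsep : ∀ j k, j < k → q j < p k)
    {t : ℝ} (ht : 0 < t) {x : Fin m → ℝ} (hx : ∀ k, x k ∈ Set.Ioo (p k) (q k))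
    (hxp : ∀ y, ∏ k, (y - q k) + t ^ 2 * ∏ k, (y - p k) = (1 + t ^ 2) * ∏ k, (y - x k))
    (k : Fin m) {y : ℝ} (hy : y ∈ Set.Ioo (p k) (q k)) :
    t < Real.sqrt (-interlacingQuotient p q y) ↔ y < x k := by
  have hp0 : ∀ j, y - p j ≠ 0 := by
    intro j
    rcases lt_trichotomy j k with h | rfl | h
    · linarith [hsep j k h, hy.1, (hx j).1, (hx j).2]
    · linarith [hy.1]
    · linarith [hsep k j h, hy.2]
  have e1 : interlacingQuotient p q y + t ^ 2 = (1 + t ^ 2) * ∏ j, (y - x j) / (y - p j) := by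
    have h1 : ∏ j, (y - p j) ≠ 0 := Finset.prod_ne_zero_iff.2 fun j _ => hp0 j
    have h2 := hxp y
    rw [interlacingQuotient, Finset.prod_div_distrib, Finset.prod_div_distrib]
    field_simp
    linarith
  rw [← Finset.mul_prod_erase _ _ (Finset.mem_univ k)] at e1
  have e2 : 0 < ∏ j ∈ Finset.univ.erase k, (y - x j) / (y - p j) := by
    refine Finset.prod_pos fun j hj => ?_
    rcases (Finset.ne_of_mem_erase hj).lt_or_gt with h | h
    · have := hsep j k h
      have := hx j
      exact div_pos (by linarith [hy.1, this.2]) (by linarith [hy.1, this.1, this.2])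
    · have := hsep k j h
      have := hx j
      exact div_pos_of_neg_of_neg (by linarith [hy.2, this.1]) (by linarith [hy.2])
  have e3 : 0 < y - p k := by linarith [hy.1]
  have e4 : interlacingQuotient p q y + t ^ 2 = (y - x k) * ((1 + t ^ 2) *
      (∏ j ∈ Finset.univ.erase k, (y - x j) / (y - p j)) / (y - p k)) := by
    rw [e1]; ring
  have e5 : 0 < (1 + t ^ 2) *
      (∏ j ∈ Finset.univ.erase k, (y - x j) / (y - p j)) / (y - p k) := by positivity
  rw [Real.lt_sqrt ht.le]
  constructor
  · intro h
    by_contra h'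
    have := mul_nonneg (sub_nonneg.2 (not_lt.1 h')) e5.le
    linarith
  · intro h
    have := mul_neg_of_neg_of_pos (sub_neg.2 h) e5
    linarith

lemma measurable_interlacingQuotient : Measurable (interlacingQuotient p q) := by
  unfold interlacingQuotient
  fun_prop

lemma interlacingQuotient_nonneg (hpq : ∀ k, p k < q k) {z : ℝ} (hz : ∀ k, q k ≤ z) :
    0 ≤ interlacingQuotient p q z :=
  Finset.prod_nonneg fun k _ => div_nonneg (by linarith [hz k]) (by linarith [hz k, hpq k])

lemma interlacingQuotient_le_one (hpq : ∀ k, p k < q k) {z : ℝ} (hz : ∀ k, q k ≤ z) :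
    interlacingQuotient p q z ≤ 1 := by
  refine Finset.prod_le_one (fun k _ => div_nonneg (by linarith [hz k]) (by linarith [hz k, hpq k]))
    fun k _ => ?_
  rw [div_le_one (by linarith [hz k, hpq k])]
  linarith [hpq k]

/-- For the measure dx/(z - x), the set where √(-r) > t is the union of the intervals (pₖ, xₖ(t)).
Its measure is log ∏(z - pₖ)/(z - xₖ) = log((1 + t²)/(r(z) + t²)), which `lintegral_log_div`
integrates over t. -/
lemma lintegral_sqrt_interlacingQuotient (hpq : ∀ k, p k < q k)
    (hsep : ∀ j k, j < k → q j < p k) {z : ℝ} (hz : ∀ k, q k ≤ z) :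
    ∫⁻ x in ⋃ k, Set.Ioo (p k) (q k),
      ENNReal.ofReal (z - x)⁻¹ * ENNReal.ofReal (Real.sqrt (-interlacingQuotient p q x)) =
    ENNReal.ofReal (Real.pi * (1 - Real.sqrt (interlacingQuotient p q z))) := by
  set U := ⋃ k, Set.Ioo (p k) (q k) with hU
  have hUm : MeasurableSet U := MeasurableSet.iUnion fun k => measurableSet_Ioo
  have hr0 := interlacingQuotient_nonneg hpq hz
  have hr1 := interlacingQuotient_le_one hpq hz
  have hm1 : Measurable fun x => ENNReal.ofReal (z - x)⁻¹ := by fun_prop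
  have hm2 : Measurable fun x => Real.sqrt (-interlacingQuotient p q x) :=
    measurable_interlacingQuotient.neg.sqrt
  have h1 := lintegral_withDensity_eq_lintegral_mul (volume.restrict U) hm1 hm2.ennreal_ofReal
  simp only [Pi.mul_apply] at h1
  rw [← h1, lintegral_eq_lintegral_meas_lt _ (.of_forall fun x => Real.sqrt_nonneg _)
    hm2.aemeasurable, ← lintegral_log_div (Real.sqrt_nonneg _) (Real.sqrt_le_one.2 hr1)]
  refine setLIntegral_congr_fun measurableSet_Ioi fun t ht => ?_
  have ht : 0 < t := ht
  obtain ⟨x, hx, hxp⟩ := exists_interlacing_roots hpq hsep (pow_pos ht 2)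
  have hset : {y | t < Real.sqrt (-interlacingQuotient p q y)} ∩ U = ⋃ k, Set.Ioo (p k) (x k) := by
    ext y
    simp only [hU, Set.mem_inter_iff, Set.mem_ofPred_eq, Set.mem_iUnion]
    constructor
    · rintro ⟨h, k, hk⟩
      exact ⟨k, hk.1, (lt_sqrt_interlacingQuotient_iff hsep ht hx hxp k hk).1 h⟩
    · rintro ⟨k, hk⟩
      have hk' : y ∈ Set.Ioo (p k) (q k) := ⟨hk.1, hk.2.trans (hx k).2⟩
      exact ⟨(lt_sqrt_interlacingQuotient_iff hsep ht hx hxp k hk').2 hk.2, k, hk'⟩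
  have hms : MeasurableSet {y | t < Real.sqrt (-interlacingQuotient p q y)} :=
    measurableSet_lt measurable_const hm2
  have hdisj : Pairwise (Function.onFun Disjoint fun k => Set.Ioo (p k) (x k)) := by
    intro j k hjk
    refine Set.disjoint_left.2 fun y hyj hyk => ?_
    have := hx j
    have := hx k
    rcases hjk.lt_or_gt with h | h
    · linarith [hsep j k h, hyj.2, hyk.1, (hx j).2]
    · linarith [hsep k j h, hyj.1, hyk.2, (hx k).2]
  have hxz : ∀ k, x k < z := fun k => (hx k).2.trans_le (hz k)
  have hpz : ∀ k, p k < z := fun k => (hx k).1.trans (hxz k)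
  rw [withDensity_apply _ hms, Measure.restrict_restrict hms, hset,
    lintegral_iUnion (fun k => measurableSet_Ioo) hdisj, tsum_fintype,
    Finset.sum_congr rfl fun k _ => lintegral_inv_sub (hx k).1 (hxz k),
    ← ENNReal.ofReal_sum_of_nonneg, ← Real.log_prod]
  · congr 2
    rw [Real.sq_sqrt hr0, interlacingQuotient, Finset.prod_div_distrib, Finset.prod_div_distrib]
    have h2 : ∏ k, (z - p k) ≠ 0 := Finset.prod_ne_zero_iff.2 fun k _ => by linarith [hpz k]
    have h3 : ∏ k, (z - x k) ≠ 0 := Finset.prod_ne_zero_iff.2 fun k _ => by linarith [hxz k]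
    have h4 := hxp z
    have h5 : (∏ k, (z - q k)) / (∏ k, (z - p k)) + t ^ 2 =
        (1 + t ^ 2) * (∏ k, (z - x k)) / ∏ k, (z - p k) := by
      rw [← h4]; field_simp
    rw [h5]
    field_simp
  · intro k _
    have := hxz k
    have := hpz k
    exact div_ne_zero (by linarith) (by linarith)
  · intro k _
    have := hxz k
    refine Real.log_nonneg ?_
    rw [one_le_div (by linarith)]
    linarith [(hx k).1]

end Bands

/-! ### The bands, and the Stieltjes transform of the weight. -/

namespace GenCheb

section Strict

variable {g : ℕ} {α β : Fin g → ℝ}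

/-- The left endpoints of the bands. -/
def leftEnd (β : Fin g → ℝ) : Fin (g + 1) → ℝ := Fin.cons (-1) β

/-- The right endpoints of the bands. -/
def rightEnd (α : Fin g → ℝ) : Fin (g + 1) → ℝ := Fin.snoc (α := fun _ => ℝ) α 1

@[simp] lemma leftEnd_zero : leftEnd β 0 = -1 := rfl

@[simp] lemma leftEnd_succ (i : Fin g) : leftEnd β i.succ = β i := rfl

@[simp] lemma rightEnd_castSucc (i : Fin g) : rightEnd α i.castSucc = α i := by
  simp [rightEnd]

@[simp] lemma rightEnd_last : rightEnd α (Fin.last g) = 1 := by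
  simp [rightEnd]

lemma leftEnd_lt_rightEnd (hα : ∀ i, -1 < α i) (hβ : ∀ i, β i < 1)
    (hord : ∀ i j, i < j → β i < α j) (k : Fin (g + 1)) : leftEnd β k < rightEnd α k := by
  induction k using Fin.lastCases with
  | last =>
    rw [rightEnd_last]
    induction (Fin.last g) using Fin.cases with
    | zero => norm_num
    | succ i => exact hβ i
  | cast i =>
    rw [rightEnd_castSucc]
    rcases Fin.eq_zero_or_eq_succ i.castSucc with h | ⟨j, h⟩
    · rw [h, leftEnd_zero]; exact hα i
    · rw [h, leftEnd_succ]
      refine hord j i ?_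
      rw [← Fin.castSucc_lt_castSucc_iff, h]
      exact Fin.castSucc_lt_succ

lemma rightEnd_lt_leftEnd (hαβ : ∀ i, α i < β i) (hord : ∀ i j, i < j → β i < α j)
    (j k : Fin (g + 1)) (hjk : j < k) : rightEnd α j < leftEnd β k := by
  obtain ⟨k', rfl⟩ := Fin.eq_succ_of_ne_zero (Fin.ne_zero_of_lt hjk)
  obtain ⟨j', rfl⟩ := Fin.exists_castSucc_eq.2 (Fin.ne_last_of_lt hjk)
  rw [rightEnd_castSucc, leftEnd_succ]
  rcases (Fin.castSucc_lt_succ_iff.1 hjk).eq_or_lt with rfl | h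
  · exact hαβ _
  · exact (hαβ j').trans ((hord j' k' h).trans (hαβ k'))

lemma neg_one_le_leftEnd (hα : ∀ i, -1 < α i) (hαβ : ∀ i, α i < β i) (k : Fin (g + 1)) :
    -1 ≤ leftEnd β k := by
  induction k using Fin.cases with
  | zero => simp
  | succ i => rw [leftEnd_succ]; linarith [hα i, hαβ i]

lemma rightEnd_le_one (hαβ : ∀ i, α i < β i) (hβ : ∀ i, β i < 1) (k : Fin (g + 1)) :
    rightEnd α k ≤ 1 := by
  induction k using Fin.lastCases with
  | last => simp
  | cast i => rw [rightEnd_castSucc]; linarith [hβ i, hαβ i]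

lemma bands_eq_iUnion (hα : ∀ i, -1 < α i) (hαβ : ∀ i, α i < β i) (hβ : ∀ i, β i < 1)
    (hord : ∀ i j, i < j → β i < α j) :
    bands α β = ⋃ k, Set.Icc (leftEnd β k) (rightEnd α k) := by
  ext x
  simp only [bands, Set.mem_sdiff, Set.mem_iUnion, not_exists]
  constructor
  · rintro ⟨hx, hn⟩
    have hne : (Finset.univ.filter fun k => leftEnd β k ≤ x).Nonempty :=
      ⟨0, by simpa using hx.1⟩
    -- The last band that starts at or before x; beyond its right end, x would lie in the gap that
    -- follows.
    set k := (Finset.univ.filter fun k => leftEnd β k ≤ x).max' hne with hk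
    have hkx : leftEnd β k ≤ x := by
      have := Finset.max'_mem _ hne
      rw [← hk] at this
      simpa using this
    have hkm : ∀ j, k < j → x < leftEnd β j := by
      intro j hj
      by_contra h
      exact absurd (Finset.le_max' (Finset.univ.filter fun k => leftEnd β k ≤ x) j
        (by simpa using h)) (not_le.2 hj)
    refine ⟨k, hkx, ?_⟩
    rcases Fin.eq_castSucc_or_eq_last k with ⟨i, hi⟩ | hi
    · have h1 := hkm i.succ (by rw [hi]; exact Fin.castSucc_lt_succ)
      rw [leftEnd_succ] at h1
      rw [hi, rightEnd_castSucc]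
      by_contra h2
      exact hn i ⟨not_le.1 h2, h1⟩
    · rw [hi, rightEnd_last]; exact hx.2
  · rintro ⟨k, hk⟩
    refine ⟨⟨(neg_one_le_leftEnd hα hαβ k).trans hk.1, hk.2.trans (rightEnd_le_one hαβ hβ k)⟩,
      fun i hi => ?_⟩
    rcases lt_or_ge i.castSucc k with h | h
    · rcases (Fin.castSucc_lt_iff_succ_le.1 h).eq_or_lt with rfl | h'
      · have := hk.1
        rw [leftEnd_succ] at this
        linarith [hi.2]
      · have h1 := leftEnd_lt_rightEnd hα hβ hord i.succ
        have h2 := rightEnd_lt_leftEnd hαβ hord _ _ h'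
        rw [leftEnd_succ] at h1
        linarith [hi.2, hk.1]
    · rcases h.eq_or_lt with rfl | h'
      · have := hk.2
        rw [rightEnd_castSucc] at this
        linarith [hi.1]
      · have h1 := leftEnd_lt_rightEnd hα hβ hord i.castSucc
        have h2 := rightEnd_lt_leftEnd hαβ hord _ _ h'
        rw [rightEnd_castSucc] at h1
        linarith [hi.1, hk.2]

lemma bands_ae_eq_iUnion (hα : ∀ i, -1 < α i) (hαβ : ∀ i, α i < β i) (hβ : ∀ i, β i < 1)
    (hord : ∀ i j, i < j → β i < α j) :
    (bands α β : Set ℝ) =ᵐ[volume] ⋃ k, Set.Ioo (leftEnd β k) (rightEnd α k) := by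
  rw [bands_eq_iUnion hα hαβ hβ hord]
  exact Filter.EventuallyEq.countable_iUnion fun k => Ioo_ae_eq_Icc.symm

lemma interlacingQuotient_ends (x : ℝ) : interlacingQuotient (leftEnd β) (rightEnd α) x =
    (∏ i, (x - α i)) * (x - 1) / ((x + 1) * ∏ i, (x - β i)) := by
  rw [interlacingQuotient, Finset.prod_div_distrib, Fin.prod_univ_castSucc, Fin.prod_univ_succ]
  simp

/-- Splitting off (1 - x)⁻¹ leaves a quotient with numerator roots α, 1 and denominator roots -1, β,
which interlace as band endpoints. -/
lemma weight_eq {x : ℝ} (hx : x < 1) : weight α β x = 1 / Real.pi *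
    ((1 - x)⁻¹ * Real.sqrt (-interlacingQuotient (leftEnd β) (rightEnd α) x)) := by
  have h1 : 0 < 1 - x := by linarith
  have h2 : (∏ i, (x - α i)) / ((1 - x ^ 2) * ∏ i, (x - β i)) =
      -interlacingQuotient (leftEnd β) (rightEnd α) x / (1 - x) ^ 2 := by
    rw [interlacingQuotient_ends, show 1 - x ^ 2 = (1 - x) * (x + 1) by ring]
    field_simp
    ring
  rw [weight, h2, Real.sqrt_div' _ (sq_nonneg _), Real.sqrt_sq h1.le]
  ring

end Strict

end GenCheb

namespace GenCheb

section Formula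

variable {g : ℕ} {α β : Fin g → ℝ}

lemma measurableSet_bands : MeasurableSet (bands α β) :=
  measurableSet_Icc.diff (.iUnion fun _ => measurableSet_Ioo)

lemma integral_sqrt_interlacingQuotient (hα : ∀ i, -1 < α i) (hαβ : ∀ i, α i < β i)
    (hβ : ∀ i, β i < 1) (hord : ∀ i j, i < j → β i < α j) {z : ℝ} (hz : 1 ≤ z) :
    IntegrableOn (fun x => (z - x)⁻¹ *
      Real.sqrt (-interlacingQuotient (leftEnd β) (rightEnd α) x)) (bands α β) ∧
    ∫ x in bands α β, (z - x)⁻¹ * Real.sqrt (-interlacingQuotient (leftEnd β) (rightEnd α) x) =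
      Real.pi * (1 - Real.sqrt (interlacingQuotient (leftEnd β) (rightEnd α) z)) := by
  set r := interlacingQuotient (leftEnd β) (rightEnd α) with hr
  have hpq := leftEnd_lt_rightEnd hα hβ hord
  have hqz : ∀ k, rightEnd α k ≤ z := fun k => (rightEnd_le_one hαβ hβ k).trans hz
  have key := lintegral_sqrt_interlacingQuotient hpq (rightEnd_lt_leftEnd hαβ hord) hqz
  rw [← setLIntegral_congr (bands_ae_eq_iUnion hα hαβ hβ hord)] at key
  have hnn : ∀ᵐ x ∂volume.restrict (bands α β), 0 ≤ (z - x)⁻¹ := by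
    refine (ae_restrict_iff' measurableSet_bands).2
      (.of_forall fun x hx => inv_nonneg.2 (by linarith [hx.1.2]))
  have hm : Measurable fun x => (z - x)⁻¹ * Real.sqrt (-r x) :=
    Measurable.mul (by fun_prop) measurable_interlacingQuotient.neg.sqrt
  have hnn' : 0 ≤ᵐ[volume.restrict (bands α β)] fun x => (z - x)⁻¹ * Real.sqrt (-r x) := by
    filter_upwards [hnn] with x hx using mul_nonneg hx (Real.sqrt_nonneg _)
  have key' : ∫⁻ x in bands α β, ENNReal.ofReal ((z - x)⁻¹ * Real.sqrt (-r x)) =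
      ENNReal.ofReal (Real.pi * (1 - Real.sqrt (r z))) := by
    rw [← key]
    refine lintegral_congr_ae ?_
    filter_upwards [hnn] with x hx
    exact ENNReal.ofReal_mul hx
  constructor
  · refine ⟨hm.aestronglyMeasurable, ?_⟩
    rw [hasFiniteIntegral_iff_ofReal hnn', key']
    exact ENNReal.ofReal_lt_top
  · rw [integral_eq_lintegral_of_nonneg_ae hnn' hm.aestronglyMeasurable, key',
      ENNReal.toReal_ofReal]
    exact mul_nonneg Real.pi_pos.le
      (sub_nonneg.2 (Real.sqrt_le_one.2 (interlacingQuotient_le_one hpq hqz)))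

lemma ae_mem_bands_lt_one : ∀ᵐ x ∂volume.restrict (bands α β), x < 1 := by
  have h1 : ∀ᵐ x ∂volume.restrict (bands α β), x ≠ 1 :=
    ae_restrict_of_ae (by simp [ae_iff])
  filter_upwards [h1, ae_restrict_mem measurableSet_bands] with x hx hx'
  exact lt_of_le_of_ne hx'.1.2 hx

/-- The total mass is the case z = 1 of the layer-cake formula, where r vanishes. For z > 1, partial
fractions of 1/((1 - x)(z - x)) reduce the transform to the formulas at 1 and z and give √r(z)/(z -
1). -/
lemma weight_integral_strict (hα : ∀ i, -1 < α i) (hαβ : ∀ i, α i < β i)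
    (hβ : ∀ i, β i < 1) (hord : ∀ i j, i < j → β i < α j) :
    IntegrableOn (weight α β) (bands α β) ∧ ∫ x in bands α β, weight α β x = 1 ∧
    ∀ z, 1 < z → (∫ x in bands α β, weight α β x * (z - x)⁻¹) ^ 2 =
      (∏ i, (z - α i)) / ((z ^ 2 - 1) * ∏ i, (z - β i)) := by
  set r := interlacingQuotient (leftEnd β) (rightEnd α) with hr
  obtain ⟨i1, e1⟩ := integral_sqrt_interlacingQuotient hα hαβ hβ hord le_rfl
  have hw : weight α β =ᵐ[volume.restrict (bands α β)]
      fun x => 1 / Real.pi * ((1 - x)⁻¹ * Real.sqrt (-r x)) := by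
    filter_upwards [ae_mem_bands_lt_one] with x hx using weight_eq hx
  have hr1 : r 1 = 0 := by rw [hr, interlacingQuotient_ends]; simp
  rw [← hr, hr1] at e1
  refine ⟨(integrable_congr hw).2 (i1.const_mul _), ?_, fun z hz => ?_⟩
  · rw [integral_congr_ae hw, integral_const_mul, e1]
    have := Real.pi_pos
    field_simp
    simp
  · obtain ⟨i2, e2⟩ := integral_sqrt_interlacingQuotient hα hαβ hβ hord hz.le
    have hz' : z - 1 ≠ 0 := by linarith
    have hw2 : (fun x => weight α β x * (z - x)⁻¹) =ᵐ[volume.restrict (bands α β)]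
        fun x => 1 / Real.pi * (z - 1)⁻¹ *
          ((1 - x)⁻¹ * Real.sqrt (-r x) - (z - x)⁻¹ * Real.sqrt (-r x)) := by
      filter_upwards [ae_mem_bands_lt_one, hw] with x hx hx'
      rw [hx']
      have h1 : 1 - x ≠ 0 := by linarith
      have h2 : z - x ≠ 0 := by linarith
      field_simp
      ring
    rw [integral_congr_ae hw2, integral_const_mul, integral_sub i1 i2, e1, e2, ← hr]
    have hpi := Real.pi_pos
    have h3 : 1 / Real.pi * (z - 1)⁻¹ * (Real.pi * (1 - Real.sqrt 0) -
        Real.pi * (1 - Real.sqrt (r z))) = Real.sqrt (r z) / (z - 1) := by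
      rw [Real.sqrt_zero]
      field_simp
      ring
    rw [h3, div_pow, Real.sq_sqrt (interlacingQuotient_nonneg (leftEnd_lt_rightEnd hα hβ hord)
      fun k => (rightEnd_le_one hαβ hβ k).trans hz.le), interlacingQuotient_ends,
      show z ^ 2 - 1 = (z - 1) * (z + 1) by ring]
    field_simp

/-- A degenerate gap is empty and its factors cancel in the weight, so it can be deleted; this
reduces αᵢ ≤ βᵢ to the strict case. -/
lemma bands_succAbove {α β : Fin (g + 1) → ℝ} {i : Fin (g + 1)} (h : α i = β i) :
    bands (α ∘ i.succAbove) (β ∘ i.succAbove) = bands α β := by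
  ext x
  simp [bands, Fin.forall_iff_succAbove i, h, Set.mem_Ioo, not_lt]
  intro _ _ _ h
  exact h.le

lemma weight_succAbove_ae {α β : Fin (g + 1) → ℝ} {i : Fin (g + 1)} (h : α i = β i) :
    weight (α ∘ i.succAbove) (β ∘ i.succAbove) =ᵐ[volume] weight α β := by
  have h1 : ∀ᵐ x : ℝ, x ≠ β i := by simp [ae_iff]
  filter_upwards [h1] with x hx
  have hx' : x - β i ≠ 0 := sub_ne_zero.2 hx
  simp only [weight, Fin.prod_univ_succAbove _ i, h, Function.comp]
  rw [mul_left_comm, mul_div_mul_left _ _ hx']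

/-- The weight is integrable, has total mass one, and its Stieltjes transform is the square root
of a rational function. -/
lemma weight_integral (hα : ∀ i, -1 < α i) (hαβ : ∀ i, α i ≤ β i)
    (hβ : ∀ i, β i < 1) (hord : ∀ i j, i < j → β i < α j) :
    IntegrableOn (weight α β) (bands α β) ∧ ∫ x in bands α β, weight α β x = 1 ∧
    ∀ z, 1 < z → (∫ x in bands α β, weight α β x * (z - x)⁻¹) ^ 2 =
      (∏ i, (z - α i)) / ((z ^ 2 - 1) * ∏ i, (z - β i)) := by
  induction g with
  | zero => exact weight_integral_strict hα (fun i => i.elim0) hβ hord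
  | succ g ih =>
    by_cases hs : ∀ i, α i < β i
    · exact weight_integral_strict hα hs hβ hord
    push Not at hs
    obtain ⟨i, hi⟩ := hs
    have hi := (hαβ i).antisymm hi
    obtain ⟨h1, h2, h3⟩ := ih (α := α ∘ i.succAbove) (β := β ∘ i.succAbove)
      (fun k => hα _) (fun k => hαβ _) (fun k => hβ _)
      (fun j k hjk => hord _ _ (i.strictMono_succAbove hjk))
    have hw := ae_restrict_of_ae (s := bands α β) (weight_succAbove_ae hi)
    rw [bands_succAbove hi] at h1 h2 h3
    refine ⟨(integrable_congr hw).1 h1, ?_, fun z hz => ?_⟩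
    · rw [← h2]
      exact (integral_congr_ae hw).symm
    · have hz' : z - β i ≠ 0 := by linarith [hβ i]
      have h4 := h3 z hz
      rw [integral_congr_ae (g := fun x => weight α β x * (z - x)⁻¹)
        (by filter_upwards [hw] with x hx; rw [hx])] at h4
      rw [h4]
      simp only [Fin.prod_univ_succAbove _ i, hi, Function.comp]
      rw [mul_left_comm, mul_div_mul_left _ _ hz']

end Formula

end GenCheb

/-! ### The band measure and its orthogonal polynomials. -/

namespace GenCheb

variable {g : ℕ} {α β : Fin g → ℝ}

/-- The measure `w dx` on the bands. -/
noncomputable def bandMeasure (α β : Fin g → ℝ) : Measure ℝ :=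
  (volume.restrict (bands α β)).withDensity fun x => ENNReal.ofReal (weight α β x)

lemma measurable_weight : Measurable (weight α β) := by
  unfold weight
  fun_prop

lemma weight_nonneg (x : ℝ) : 0 ≤ weight α β x :=
  mul_nonneg (by positivity) (Real.sqrt_nonneg _)

lemma integral_bandMeasure (f : ℝ → ℝ) :
    ∫ x, f x ∂bandMeasure α β = ∫ x in bands α β, weight α β x * f x := by
  rw [bandMeasure, integral_withDensity_eq_integral_toReal_smul (by
    have := measurable_weight (α := α) (β := β); fun_prop) (.of_forall fun x => ENNReal.ofReal_lt_top)]
  simp only [ENNReal.toReal_ofReal (weight_nonneg _), smul_eq_mul]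

lemma pairing_bandMeasure (p q : ℝ[X]) : pairing (bandMeasure α β) p q = polyInner α β p q := by
  rw [pairing, integral_bandMeasure, polyInner]
  simp only [mul_comm (weight α β _)]

lemma isFiniteMeasure_bandMeasure (hw : IntegrableOn (weight α β) (bands α β)) :
    IsFiniteMeasure (bandMeasure α β) :=
  isFiniteMeasure_withDensity_ofReal hw.2

lemma ae_mem_bands : ∀ᵐ x ∂bandMeasure α β, x ∈ bands α β :=
  (withDensity_absolutelyContinuous _ _).ae_le (ae_restrict_mem measurableSet_bands)

lemma bandMeasure_singleton (x : ℝ) : bandMeasure α β {x} = 0 :=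
  ((withDensity_absolutelyContinuous _ _).trans Measure.restrict_le_self.absolutelyContinuous)
    (by simp)

lemma bandMeasure_ne_zero (hw : ∫ x in bands α β, weight α β x = 1) : bandMeasure α β ≠ 0 := by
  intro h
  have := integral_bandMeasure (α := α) (β := β) fun _ => 1
  rw [h] at this
  simp [hw] at this

lemma P_degree (n : ℕ) : (P α β n).Monic ∧ (P α β n).natDegree = n := by
  induction n using Nat.strong_induction_on with
  | _ n ih =>
    have h : (∑ k : Fin n, C (polyInner α β (X ^ n) (P α β k) /
        polyInner α β (P α β k) (P α β k)) * P α β k).degree < n := by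
      refine (degree_sum_le _ _).trans_lt ((Finset.sup_lt_iff (WithBot.bot_lt_coe n)).2 ?_)
      intro k _
      refine (degree_C_mul_le _ _).trans_lt ?_
      rw [degree_eq_natDegree (ih k k.2).1.ne_zero, (ih k k.2).2]
      exact Nat.cast_lt.2 k.2
    rw [P]
    rw [← degree_X_pow (R := ℝ) n] at h
    constructor
    · exact (monic_X_pow n).sub_of_left h
    · rw [natDegree_eq_of_degree_eq (degree_sub_eq_left_of_degree_lt h), natDegree_X_pow]

lemma isOrthogonalSystem (hα : ∀ i, -1 < α i) (hαβ : ∀ i, α i ≤ β i)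
    (hβ : ∀ i, β i < 1) (hord : ∀ i j, i < j → β i < α j) :
    IsOrthogonalSystem (bandMeasure α β) (bands α β) (P α β) := by
  obtain ⟨h1, h2, -⟩ := weight_integral hα hαβ hβ hord
  have := isFiniteMeasure_bandMeasure h1
  have hE := ae_mem_bands (α := α) (β := β)
  have hs : bands α β ⊆ Set.Icc (-1) 1 := Set.sdiff_subset
  refine ⟨hE, hs, bandMeasure_singleton, bandMeasure_ne_zero h2, fun n => (P_degree n).1,
    fun n => (P_degree n).2, fun m n => ?_⟩
  induction n using Nat.strong_induction_on generalizing m with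
  | _ n ih =>
    intro hmn
    have hpos : pairing (bandMeasure α β) (P α β m) (P α β m) ≠ 0 :=
      (pairing_self_pos_of_ne_zero hE hs (bandMeasure_ne_zero h2) bandMeasure_singleton
        (P_degree m).1.ne_zero).ne'
    rw [P, pairing_sub_left hE hs, pairing_sum_left hE hs, Finset.sum_eq_single ⟨m, hmn⟩]
    · rw [pairing_C_mul_left, ← pairing_bandMeasure, ← pairing_bandMeasure]
      field_simp
      ring
    · intro k _ hk
      rw [pairing_C_mul_left]
      have hk' : (k : ℕ) ≠ m := fun h => hk (Fin.ext h)
      rcases hk'.lt_or_gt with h | h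
      · rw [pairing_comm, ih m hmn k h, mul_zero]
      · rw [ih k k.2 m h, mul_zero]
    · simp

lemma h_eq (n : ℕ) : h α β n = pairing (bandMeasure α β) (P α β n) (P α β n) :=
  (pairing_bandMeasure _ _).symm

end GenCheb

/-! ### Decaying solutions of periodic three-term recurrences. -/

/-- `y` solves the three-term recurrence `yₙ₊₂ = (z - bₙ₊₁) yₙ₊₁ - (hₙ₊₁ / hₙ) yₙ`. -/
def IsRecSolution (h b : ℕ → ℝ) (z : ℝ) (y : ℕ → ℝ) : Prop :=
  ∀ n, y (n + 2) = (z - b (n + 1)) * y (n + 1) - h (n + 1) / h n * y n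

/-- From index `1` on, `b` has period `K` and `h` has multiplicative period `K`, with factor `A`. -/
structure IsPeriodicData (h b : ℕ → ℝ) (K : ℕ) (A : ℝ) : Prop where
  pos : ∀ n, 0 < h n
  shift_b : ∀ n, b (n + K) = b n
  shift_h : ∀ n, 1 ≤ n → h (n + K) = A * h n
  period_pos : 1 ≤ K

namespace IsPeriodicData

variable {h b : ℕ → ℝ} {K : ℕ} {A z : ℝ} {y : ℕ → ℝ}

lemma factor_pos (D : IsPeriodicData h b K A) : 0 < A := by
  have h1 := D.shift_h 1 le_rfl
  have h2 := D.pos (1 + K)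
  rw [h1] at h2
  exact pos_of_mul_pos_left h2 (D.pos 1).le

lemma shift_h_mul (D : IsPeriodicData h b K A) {n : ℕ} (hn : 1 ≤ n) (m : ℕ) :
    h (n + m * K) = A ^ m * h n := by
  induction m with
  | zero => simp
  | succ m ih =>
    rw [show n + (m + 1) * K = n + m * K + K by ring, D.shift_h _ (by omega), ih]
    ring

lemma shift_recurrence (D : IsPeriodicData h b K A) (hy : IsRecSolution h b z y) {n : ℕ}
    (hn : 1 ≤ n) : y (n + 2 + K) =
      (z - b (n + 1)) * y (n + 1 + K) - h (n + 1) / h n * y (n + K) := by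
  have h1 := hy (n + K)
  have h2 : h (n + K + 1) / h (n + K) = h (n + 1) / h n := by
    rw [show n + K + 1 = n + 1 + K by ring, D.shift_h n hn, D.shift_h (n + 1) (by omega),
      mul_div_mul_left _ _ D.factor_pos.ne']
  rw [h2, show n + K + 1 = n + 1 + K by ring, D.shift_b] at h1
  rw [show n + 2 + K = n + K + 2 by ring, h1]

/-- From index 1 on, y and its shift solve the same recurrence, so each step multiplies their
Casoratian by a ratio of consecutive values of h. Index 0 is excluded because a₁ is not part of the
period. -/
lemma casoratian_shift (D : IsPeriodicData h b K A) (hy : IsRecSolution h b z y) (n : ℕ) :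
    h 1 * (y (n + 2 + K) * y (n + 1) - y (n + 2) * y (n + 1 + K)) =
      h (n + 1) * (y (2 + K) * y 1 - y 2 * y (1 + K)) := by
  induction n with
  | zero => simp
  | succ n ih =>
    have h1 := D.shift_recurrence hy (n := n + 1) (by omega)
    have h2 := hy (n + 1)
    have h3 := (D.pos (n + 1)).ne'
    rw [show n + 1 + 2 + K = n + 1 + 2 + K from rfl, h1, h2]
    rw [show n + 1 + 1 = n + 2 from rfl]
    field_simp
    linear_combination h (n + 2) * ih

lemma tendsto_sq_div_pow (D : IsPeriodicData h b K A)
    (hd : Filter.Tendsto (fun n => y n ^ 2 / h n) Filter.atTop (nhds 0)) {j : ℕ} (hj : 1 ≤ j) :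
    Filter.Tendsto (fun m => y (j + m * K) ^ 2 / A ^ m) Filter.atTop (nhds 0) := by
  have h1 : Filter.Tendsto (fun m => j + m * K) Filter.atTop Filter.atTop :=
    Filter.tendsto_atTop_mono (fun m => le_add_left (Nat.le_mul_of_pos_right m D.period_pos)) Filter.tendsto_id
  have h2 := (hd.comp h1).const_mul (h j)
  rw [mul_zero] at h2
  refine h2.congr fun m => ?_
  have := (D.pos j).ne'
  have := (pow_pos D.factor_pos m).ne'
  simp only [Function.comp, D.shift_h_mul hj]
  field_simp

/-- After m periods the Casoratian equals AᵐW, while it is bounded by a sum of squares of y that is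
o(Aᵐ) by the decay hypothesis. Hence W = 0. -/
lemma casoratian_eq_zero (D : IsPeriodicData h b K A) (hy : IsRecSolution h b z y)
    (hd : Filter.Tendsto (fun n => y n ^ 2 / h n) Filter.atTop (nhds 0)) :
    y (2 + K) * y 1 - y 2 * y (1 + K) = 0 := by
  set W := y (2 + K) * y 1 - y 2 * y (1 + K) with hW
  have hA := D.factor_pos
  have t1 := D.tendsto_sq_div_pow hd (j := 1) le_rfl
  have t2 := D.tendsto_sq_div_pow hd (j := 2) (by norm_num)
  have t3 := (((t2.comp (Filter.tendsto_add_atTop_nat 1)).const_mul A).add t1).add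
    (t2.add ((t1.comp (Filter.tendsto_add_atTop_nat 1)).const_mul A))
  simp only [mul_zero, add_zero] at t3
  have hle : ∀ m : ℕ, |W| ≤ A * (y (2 + (m + 1) * K) ^ 2 / A ^ (m + 1)) +
      y (1 + m * K) ^ 2 / A ^ m + (y (2 + m * K) ^ 2 / A ^ m +
        A * (y (1 + (m + 1) * K) ^ 2 / A ^ (m + 1))) := by
    intro m
    have hAm := pow_pos hA m
    have h1 := D.casoratian_shift hy (m * K)
    rw [show m * K + 1 = 1 + m * K by ring, D.shift_h_mul le_rfl,
      show m * K + 2 + K = 2 + (m + 1) * K by ring, show m * K + 2 = 2 + m * K by ring,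
      show 1 + m * K + K = 1 + (m + 1) * K by ring] at h1
    have h2 : y (2 + (m + 1) * K) * y (1 + m * K) - y (2 + m * K) * y (1 + (m + 1) * K) =
        A ^ m * W := mul_left_cancel₀ (D.pos 1).ne' (by linear_combination h1)
    have h3 : A * (y (2 + (m + 1) * K) ^ 2 / A ^ (m + 1)) +
      y (1 + m * K) ^ 2 / A ^ m + (y (2 + m * K) ^ 2 / A ^ m +
        A * (y (1 + (m + 1) * K) ^ 2 / A ^ (m + 1))) = (y (2 + (m + 1) * K) ^ 2 +
        y (1 + m * K) ^ 2 + y (2 + m * K) ^ 2 + y (1 + (m + 1) * K) ^ 2) / A ^ m := by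
      rw [pow_succ]
      field_simp
      ring
    rw [h3, le_div_iff₀ hAm, ← abs_of_pos hAm, ← abs_mul, mul_comm, ← h2, abs_le]
    generalize y (2 + (m + 1) * K) = p
    generalize y (1 + m * K) = q
    generalize y (2 + m * K) = r
    generalize y (1 + (m + 1) * K) = s
    constructor
    · nlinarith [sq_nonneg (p + q), sq_nonneg (r - s), sq_nonneg p, sq_nonneg q, sq_nonneg r,
        sq_nonneg s]
    · nlinarith [sq_nonneg (p - q), sq_nonneg (r + s), sq_nonneg p, sq_nonneg q, sq_nonneg r,
        sq_nonneg s]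
  have := ge_of_tendsto' t3 hle
  exact abs_nonpos_iff.1 this

/-- A solution whose Casoratian with its shift vanishes is multiplied by a constant under the
shift. -/
lemma exists_multiplier (D : IsPeriodicData h b K A) (hy : IsRecSolution h b z y)
    (hW : y (2 + K) * y 1 - y 2 * y (1 + K) = 0) (h0 : y 1 ≠ 0 ∨ y 2 ≠ 0) :
    ∃ l, ∀ n, 1 ≤ n → y (n + K) = l * y n := by
  obtain ⟨l, hl1, hl2⟩ : ∃ l, y (1 + K) = l * y 1 ∧ y (2 + K) = l * y 2 := by
    by_cases h1 : y 1 = 0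
    · have h2 := h0.resolve_left (not_not.2 h1)
      refine ⟨y (2 + K) / y 2, ?_, by field_simp⟩
      rw [h1, mul_zero, zero_sub, neg_eq_zero] at hW
      rw [h1, mul_zero]
      exact (mul_eq_zero.1 hW).resolve_left h2
    · refine ⟨y (1 + K) / y 1, by field_simp, ?_⟩
      field_simp
      linarith
  refine ⟨l, fun n hn => ?_⟩
  have key : ∀ m, y (m + 1 + K) = l * y (m + 1) ∧ y (m + 2 + K) = l * y (m + 2) := by
    intro m
    induction m with
    | zero => exact ⟨hl1, hl2⟩
    | succ m ih =>
      refine ⟨ih.2, ?_⟩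
      rw [D.shift_recurrence hy (n := m + 1) (by omega), hy (m + 1), ih.1,
        show m + 1 + 1 + K = m + 2 + K from rfl, ih.2]
      ring
  obtain ⟨m, rfl⟩ := Nat.exists_eq_add_of_le' hn
  exact (key m).1

/-- The multiplier of a decaying solution satisfies `l² ≤ A`. -/
lemma multiplier_sq_le (D : IsPeriodicData h b K A)
    (hd : Filter.Tendsto (fun n => y n ^ 2 / h n) Filter.atTop (nhds 0))
    (h0 : y 1 ≠ 0 ∨ y 2 ≠ 0) {l : ℝ} (hl : ∀ n, 1 ≤ n → y (n + K) = l * y n) : l ^ 2 ≤ A := by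
  obtain ⟨j, hj, hyj⟩ : ∃ j, 1 ≤ j ∧ y j ≠ 0 := by
    rcases h0 with h | h
    · exact ⟨1, le_rfl, h⟩
    · exact ⟨2, by norm_num, h⟩
  have hA := D.factor_pos
  by_contra hlt
  have hlt := (not_le.1 hlt).le
  have h1 : ∀ m, y (j + m * K) = l ^ m * y j := by
    intro m
    induction m with
    | zero => simp
    | succ m ih =>
      rw [show j + (m + 1) * K = j + m * K + K by ring, hl _ (by omega), ih]
      ring
  -- The right side is (l²/A)ᵐ yⱼ², which cannot tend to 0 when l² > A.
  have h2 : ∀ m : ℕ, y j ^ 2 ≤ y (j + m * K) ^ 2 / A ^ m := by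
    intro m
    rw [h1, le_div_iff₀ (pow_pos hA m), mul_pow, ← pow_mul, mul_comm m 2, pow_mul, mul_comm]
    exact mul_le_mul_of_nonneg_right (pow_le_pow_left₀ hA.le hlt m) (sq_nonneg _)
  have h3 := ge_of_tendsto' (D.tendsto_sq_div_pow hd hj) h2
  exact absurd h3 (not_le.2 (by positivity))

end IsPeriodicData

/-! ### The quadratic equation for F and the conjugate solution. -/

namespace IsOrthogonalSystem

variable {ν : Measure ℝ} {E : Set ℝ} {P : ℕ → ℝ[X]}

/-- The squared norms. -/
noncomputable def sqNorm (ν : Measure ℝ) (P : ℕ → ℝ[X]) (n : ℕ) : ℝ := pairing ν (P n) (P n)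

/-- The diagonal recurrence coefficients. -/
noncomputable def diagCoeff (ν : Measure ℝ) (P : ℕ → ℝ[X]) (n : ℕ) : ℝ :=
  pairing ν (X * P n) (P n) / pairing ν (P n) (P n)

/-- The polynomials of the second kind. -/
noncomputable def secondKind (ν : Measure ℝ) (P : ℕ → ℝ[X]) : ℕ → ℝ[X]
  | 0 => 0
  -- Forced by ψ₁ = P₁F - h₀, so that Qₙ = PₙF - ψₙ for every n.
  | 1 => C (sqNorm ν P 0)
  | n + 2 => (X - C (diagCoeff ν P (n + 1))) * secondKind ν P (n + 1) -
      C (sqNorm ν P (n + 1) / sqNorm ν P n) * secondKind ν P n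

lemma isRecSolution_secondKind (z : ℝ) :
    IsRecSolution (sqNorm ν P) (diagCoeff ν P) z fun n => (secondKind ν P n).eval z := by
  intro n
  simp [secondKind]

variable [IsFiniteMeasure ν]

lemma isRecSolution_eval (H : IsOrthogonalSystem ν E P) (z : ℝ) :
    IsRecSolution (sqNorm ν P) (diagCoeff ν P) z fun n => (P n).eval z := by
  intro n
  simp only [H.recurrence n, sqNorm, diagCoeff]
  simp

lemma isRecSolution_cauchy (H : IsOrthogonalSystem ν E P) {z : ℝ} (hz : IsAway E z) :
    IsRecSolution (sqNorm ν P) (diagCoeff ν P) z fun n => cauchyTransform ν (P n) z :=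
  H.cauchy_add_two hz

lemma cauchy_eq (H : IsOrthogonalSystem ν E P) {z : ℝ} (hz : IsAway E z) (n : ℕ) :
    cauchyTransform ν (P n) z =
      (P n).eval z * cauchyTransform ν (P 0) z - (secondKind ν P n).eval z := by
  suffices h : ∀ n, (cauchyTransform ν (P n) z =
      (P n).eval z * cauchyTransform ν (P 0) z - (secondKind ν P n).eval z) ∧
      (cauchyTransform ν (P (n + 1)) z =
      (P (n + 1)).eval z * cauchyTransform ν (P 0) z - (secondKind ν P (n + 1)).eval z) from (h n).1
  intro n
  induction n with
  | zero =>
    constructor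
    · simp [H.apply_zero, secondKind]
    · rw [zero_add, H.cauchy_one hz, H.apply_one]
      simp [secondKind, sqNorm]
  | succ n ih =>
    refine ⟨ih.2, ?_⟩
    have h1 := H.isRecSolution_cauchy hz n
    have h2 := H.isRecSolution_eval z n
    have h3 := isRecSolution_secondKind (ν := ν) (P := P) z n
    simp only at h1 h2 h3
    rw [show n + 1 + 1 = n + 2 from rfl, h1, h2, h3, ih.1, ih.2]
    ring

end IsOrthogonalSystem

lemma eventually_eval_ne_zero {p : ℝ[X]} (hp : p ≠ 0) (x : ℝ) :
    ∀ᶠ z in nhdsWithin x {x}ᶜ, p.eval z ≠ 0 := by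
  have hfin : (p.rootSet ℝ \ {x}).Finite := (p.rootSet_finite ℝ).sdiff
  filter_upwards [mem_nhdsWithin_of_mem_nhds (hfin.isClosed.isOpen_compl.mem_nhds
    (show x ∈ (p.rootSet ℝ \ {x})ᶜ by simp)), self_mem_nhdsWithin] with z hz hzx h
  exact hz ⟨(mem_rootSet_of_ne hp).2 (by simpa using h), hzx⟩

lemma eq_zero_of_eval_gt_one {p : ℝ[X]} (h : ∀ z, 1 < z → p.eval z = 0) : p = 0 :=
  eq_zero_of_infinite_isRoot p ((Set.Ioi_infinite (1 : ℝ)).mono fun z hz => h z hz)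

/-- If `A / B` has odd order at `1`, then `s = b √(A / B) B` with polynomials `s`, `b` forces
`s = b = 0`. -/
lemma eq_zero_of_sq_eq_mul {s b A B : ℝ[X]} (hA : A.eval 1 ≠ 0) (hB : B.eval 1 ≠ 0)
    (h : s ^ 2 = b ^ 2 * (A * ((X - C 1) * B))) : s = 0 ∧ b = 0 := by
  have hA0 : A ≠ 0 := by rintro rfl; simp at hA
  have hB0 : B ≠ 0 := by rintro rfl; simp at hB
  have hX : (X - C 1 : ℝ[X]) ≠ 0 := X_sub_C_ne_zero 1
  by_cases hb : b = 0
  · subst hb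
    refine ⟨?_, rfl⟩
    simpa using h
  · exfalso
    have hs : s ≠ 0 := by
      rintro rfl
      have : b ^ 2 * (A * ((X - C 1) * B)) ≠ 0 :=
        mul_ne_zero (pow_ne_zero 2 hb) (mul_ne_zero hA0 (mul_ne_zero hX hB0))
      exact this (by rw [← h]; simp)
    have h1 := congrArg (rootMultiplicity 1) h
    rw [sq, sq, rootMultiplicity_mul (mul_ne_zero hs hs),
      rootMultiplicity_mul (mul_ne_zero (mul_ne_zero hb hb)
        (mul_ne_zero hA0 (mul_ne_zero hX hB0))), rootMultiplicity_mul (mul_ne_zero hb hb),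
      rootMultiplicity_mul (mul_ne_zero hA0 (mul_ne_zero hX hB0)),
      rootMultiplicity_mul (mul_ne_zero hX hB0), rootMultiplicity_X_sub_C_self,
      rootMultiplicity_eq_zero hA, rootMultiplicity_eq_zero hB] at h1
    -- Parity: twice the order of s at 1 would be twice the order of b plus one.
    omega

namespace IsOrthogonalSystem

variable {ν : Measure ℝ} {E : Set ℝ} {P : ℕ → ℝ[X]} {K : ℕ} {A z : ℝ}

/-- The coefficient of `F ^ 2` in the quadratic equation satisfied by `F = ∫ dν / (z - x)`. -/
noncomputable def quadA (P : ℕ → ℝ[X]) (K : ℕ) : ℝ[X] := P (2 + K) * P 1 - P 2 * P (1 + K)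

/-- The coefficient of `-F` in the quadratic equation satisfied by `F = ∫ dν / (z - x)`. -/
noncomputable def quadB (ν : Measure ℝ) (P : ℕ → ℝ[X]) (K : ℕ) : ℝ[X] :=
  P (2 + K) * secondKind ν P 1 + secondKind ν P (2 + K) * P 1 -
    P 2 * secondKind ν P (1 + K) - secondKind ν P 2 * P (1 + K)

/-- The constant coefficient of the quadratic equation satisfied by `F = ∫ dν / (z - x)`. -/
noncomputable def quadC (ν : Measure ℝ) (P : ℕ → ℝ[X]) (K : ℕ) : ℝ[X] :=
  secondKind ν P (2 + K) * secondKind ν P 1 - secondKind ν P 2 * secondKind ν P (1 + K)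

lemma isAway_of_one_lt (H : IsOrthogonalSystem ν E P) (hz : 1 < z) : IsAway E z := by
  refine ⟨z - 1, by linarith, fun x hx => ?_⟩
  have := (H.subset hx).2
  exact (by linarith : z - 1 ≤ z - x).trans (le_abs_self _)

variable [IsFiniteMeasure ν]

lemma quadratic (H : IsOrthogonalSystem ν E P)
    (D : IsPeriodicData (sqNorm ν P) (diagCoeff ν P) K A) (hz : IsAway E z) :
    (quadA P K).eval z * cauchyTransform ν (P 0) z ^ 2 -
      (quadB ν P K).eval z * cauchyTransform ν (P 0) z + (quadC ν P K).eval z = 0 := by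
  have h := D.casoratian_eq_zero (H.isRecSolution_cauchy hz) (H.tendsto_cauchy_sq_div hz)
  simp only [H.cauchy_eq hz (2 + K), H.cauchy_eq hz (1 + K), H.cauchy_eq hz 2,
    H.cauchy_eq hz 1] at h
  simp only [quadA, quadB, quadC, eval_sub, eval_add, eval_mul]
  linear_combination h

/-- Put L = (X - 1)M. For z > 1 the quadratic equation gives `quadA`·N + `quadC`·L = `quadB`·F·L.
Squaring with F²L = N gives a polynomial identity with right side `quadB`²·N·L, and NL has a simple
zero at 1, so it cannot relate two nonzero squares. -/
lemma quad_eq_zero (H : IsOrthogonalSystem ν E P)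
    (D : IsPeriodicData (sqNorm ν P) (diagCoeff ν P) K A) {N M : ℝ[X]} (hN : N.eval 1 ≠ 0)
    (hM : M.eval 1 ≠ 0)
    (hF : ∀ z, 1 < z → cauchyTransform ν (P 0) z ^ 2 * ((X - C 1) * M).eval z = N.eval z) :
    quadA P K * N + quadC ν P K * ((X - C 1) * M) = 0 ∧ quadB ν P K = 0 := by
  apply eq_zero_of_sq_eq_mul hN hM
  rw [← sub_eq_zero]
  refine eq_zero_of_eval_gt_one fun z hz => ?_
  have h1 := hF z hz
  have h2 := H.quadratic D (H.isAway_of_one_lt hz)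
  have h3 : (quadA P K).eval z * N.eval z + (quadC ν P K).eval z * ((X - C 1) * M).eval z =
      (quadB ν P K).eval z * cauchyTransform ν (P 0) z * ((X - C 1) * M).eval z := by
    rw [← h1]
    linear_combination ((X - C 1) * M).eval z * h2
  rw [eval_sub, eval_pow, eval_add, eval_mul, eval_mul, h3, eval_mul (p := quadB ν P K ^ 2),
    eval_mul (p := N), eval_pow, ← h1]
  ring

/-- Write K = k + 1. If `quadA` vanished, the recurrences at both ends and a comparison of leading
coefficients would give Pₖ₊₂ = P₁Pₖ₊₁. By periodicity of b the recurrence for Pₖ₊₂ has the same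
leading factor P₁ but subtracts a nonzero multiple of Pₖ. -/
lemma quadA_ne_zero (H : IsOrthogonalSystem ν E P)
    (D : IsPeriodicData (sqNorm ν P) (diagCoeff ν P) K A) : quadA P K ≠ 0 := by
  intro h
  obtain ⟨k, rfl⟩ := Nat.exists_eq_add_of_le' D.period_pos
  have hb0 := D.shift_b 0
  have hb1 := D.shift_b 1
  have hp0 := D.pos 0
  have hp1 := D.pos 1
  have hpk := D.pos k
  have hpk1 := D.pos (k + 1)
  have hpk2 := D.pos (k + 2)
  set s := sqNorm ν P with hs
  set b := diagCoeff ν P with hb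
  have r0 : P 1 = X - C (b 0) := H.apply_one
  have r2 : P 2 = (X - C (b 1)) * P 1 - C (s 1 / s 0) * P 0 := H.recurrence 0
  have rk2 : P (k + 2) = (X - C (b (k + 1))) * P (k + 1) - C (s (k + 1) / s k) * P k :=
    H.recurrence k
  have rk3 : P (k + 3) = (X - C (b (k + 2))) * P (k + 2) - C (s (k + 2) / s (k + 1)) * P (k + 1) :=
    H.recurrence (k + 1)
  rw [show 0 + (k + 1) = k + 1 by ring] at hb0
  rw [show 1 + (k + 1) = k + 2 by ring] at hb1
  rw [hb1] at rk3
  rw [hb0, ← r0] at rk2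
  rw [quadA, show 2 + (k + 1) = k + 3 by ring, show 1 + (k + 1) = k + 2 by ring, r2, rk3,
    H.apply_zero] at h
  have h1 : C (s 1 / s 0) * P (k + 2) = C (s (k + 2) / s (k + 1)) * (P 1 * P (k + 1)) := by
    linear_combination h
  have h2 := congrArg leadingCoeff h1
  rw [leadingCoeff_mul, leadingCoeff_mul, leadingCoeff_C, leadingCoeff_C, (H.monic _).leadingCoeff,
    ((H.monic 1).mul (H.monic (k + 1))).leadingCoeff, mul_one, mul_one] at h2
  rw [← h2] at h1
  have h3 : (C (s 1 / s 0) : ℝ[X]) ≠ 0 := C_ne_zero.2 (by positivity)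
  have h4 := mul_left_cancel₀ h3 h1
  rw [rk2, sub_eq_self] at h4
  rcases mul_eq_zero.1 h4 with h5 | h5
  · exact (C_ne_zero.2 (by positivity)) h5
  · exact (H.monic k).ne_zero h5

lemma cauchy_ne_zero_or (H : IsOrthogonalSystem ν E P) (hz : IsAway E z) :
    cauchyTransform ν (P 1) z ≠ 0 ∨ cauchyTransform ν (P 2) z ≠ 0 := by
  by_contra! h
  have h1 := H.wronskian hz 1
  rw [h.1, h.2] at h1
  linarith [H.norm_pos 1]

/-- The functions of the second kind are multiplied by a nonzero constant under the shift. -/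
lemma exists_cauchy_multiplier (H : IsOrthogonalSystem ν E P)
    (D : IsPeriodicData (sqNorm ν P) (diagCoeff ν P) K A) (hz : IsAway E z) :
    ∃ l, l ≠ 0 ∧ l ^ 2 ≤ A ∧
      ∀ n, 1 ≤ n → cauchyTransform ν (P (n + K)) z = l * cauchyTransform ν (P n) z := by
  have hs := H.isRecSolution_cauchy hz
  have hd := H.tendsto_cauchy_sq_div hz
  have h0 := H.cauchy_ne_zero_or hz
  obtain ⟨l, hl⟩ := D.exists_multiplier hs (D.casoratian_eq_zero hs hd) h0
  refine ⟨l, ?_, D.multiplier_sq_le hd h0 hl, hl⟩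
  rintro rfl
  have h1 := H.wronskian hz (1 + K)
  rw [show 1 + K + 1 = 2 + K by ring, hl 1 le_rfl, hl 2 (by norm_num)] at h1
  linarith [H.norm_pos (1 + K)]

/-- Comparison of `n` and `n + K` at a point off `E` at which `F < 0`. -/
lemma shift_comparison (H : IsOrthogonalSystem ν E P)
    (D : IsPeriodicData (sqNorm ν P) (diagCoeff ν P) K A) (hB : quadB ν P K = 0)
    (hz : IsAway E z) (hF : cauchyTransform ν (P 0) z < 0) {n : ℕ} (hn : 1 ≤ n) :
    A * ((P n).eval z * cauchyTransform ν (P n) z) ≤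
      (P (n + K)).eval z * cauchyTransform ν (P (n + K)) z ∧
    (P (n + K)).eval z ^ 2 * cauchyTransform ν (P 0) z ^ 2 - (secondKind ν P (n + K)).eval z ^ 2 =
      A * ((P n).eval z ^ 2 * cauchyTransform ν (P 0) z ^ 2 - (secondKind ν P n).eval z ^ 2) := by
  obtain ⟨l, hl0, hlA, hl⟩ := H.exists_cauchy_multiplier D hz
  set F := cauchyTransform ν (P 0) z with hFdef
  have hψ := H.cauchy_eq hz
  rw [← hFdef] at hψ
  -- The conjugate of ψ, with F replaced by -F. As `quadB` = 0, -F is the other root of the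
  -- quadratic, so this solution also has zero Casoratian with its shift.
  set y : ℕ → ℝ := fun n => -((P n).eval z * F) - (secondKind ν P n).eval z with hy
  have hys : IsRecSolution (sqNorm ν P) (diagCoeff ν P) z y := by
    intro n
    have h1 := H.isRecSolution_eval z n
    have h2 := isRecSolution_secondKind (ν := ν) (P := P) z n
    simp only at h1 h2
    simp only [hy, h1, h2]
    ring
  have hyW : y (2 + K) * y 1 - y 2 * y (1 + K) = 0 := by
    have h1 := H.quadratic D hz
    have h2 := congrArg (eval z) hB
    simp only [quadB, eval_zero] at h2
    simp only [quadA, quadB, quadC, eval_sub, eval_add, eval_mul] at h1 h2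
    simp only [hy]
    linear_combination h1 + 2 * F * h2
  have hW : ∀ n, cauchyTransform ν (P (n + 1)) z * y n - cauchyTransform ν (P n) z * y (n + 1) =
      2 * F * sqNorm ν P n := by
    intro n
    have h1 := H.wronskian hz n
    rw [sqNorm, ← h1, hψ n, hψ (n + 1)]
    simp only [hy]
    ring
  have hy0 : y 1 ≠ 0 ∨ y 2 ≠ 0 := by
    by_contra! h
    have h1 := hW 1
    rw [h.1, h.2] at h1
    have h2 := mul_neg_of_neg_of_pos hF (D.pos 1)
    linarith
  obtain ⟨k, hk⟩ := D.exists_multiplier hys hyW hy0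
  -- The Casoratian of ψ and y is 2Fhₙ; over one period it is multiplied by lk and by A.
  have hlk : l * k = A := by
    have h1 := hW (1 + K)
    rw [show 1 + K + 1 = 2 + K by ring, hl 1 le_rfl, hl 2 (by norm_num), hk 1 le_rfl,
      hk 2 (by norm_num), D.shift_h 1 le_rfl] at h1
    have h2 := hW 1
    have h3 := mul_neg_of_neg_of_pos hF (D.pos 1)
    have h4 : (2 * F * sqNorm ν P 1) * (l * k) = (2 * F * sqNorm ν P 1) * A := by
      rw [show 1 + 1 = 2 from rfl] at h2
      linear_combination h1 - l * k * h2
    exact mul_left_cancel₀ (by linarith) h4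
  have e1 := hl n hn
  have e2 := hk n hn
  have e3 : (2 * F) * (P n).eval z = cauchyTransform ν (P n) z - y n := by
    rw [hψ n]; simp only [hy]; ring
  have e4 : (2 * F) * (P (n + K)).eval z = l * cauchyTransform ν (P n) z - k * y n := by
    rw [← e1, ← e2, hψ (n + K)]; simp only [hy]; ring
  constructor
  · have h1 : (2 * F) * ((P (n + K)).eval z * cauchyTransform ν (P (n + K)) z) ≤
        (2 * F) * (A * ((P n).eval z * cauchyTransform ν (P n) z)) := by
      have h2 : (2 * F) * ((P (n + K)).eval z * cauchyTransform ν (P (n + K)) z) =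
          l ^ 2 * cauchyTransform ν (P n) z ^ 2 - A * (cauchyTransform ν (P n) z * y n) := by
        rw [e1, ← hlk]
        linear_combination l * cauchyTransform ν (P n) z * e4
      have h3 : (2 * F) * (A * ((P n).eval z * cauchyTransform ν (P n) z)) =
          A * cauchyTransform ν (P n) z ^ 2 - A * (cauchyTransform ν (P n) z * y n) := by
        linear_combination A * cauchyTransform ν (P n) z * e3
      rw [h2, h3]
      have := mul_le_mul_of_nonneg_right hlA (sq_nonneg (cauchyTransform ν (P n) z))
      linarith
    exact (mul_le_mul_left_of_neg (by linarith)).1 h1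
  · have h1 : ∀ n, (P n).eval z ^ 2 * F ^ 2 - (secondKind ν P n).eval z ^ 2 =
        -(cauchyTransform ν (P n) z * y n) := by
      intro n
      rw [hψ n]; simp only [hy]; ring
    rw [h1, h1, e1, e2, ← hlk]
    ring

/-- This carries F²M = N from z > 1 into the gaps without evaluating the integral there: with
`quadB` = 0 the quadratic is `quadA`·F² + `quadC` = 0. -/
lemma eval_eq_of_quad (H : IsOrthogonalSystem ν E P)
    (D : IsPeriodicData (sqNorm ν P) (diagCoeff ν P) K A) (hB : quadB ν P K = 0) {N M : ℝ[X]}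
    (hAC : quadA P K * N + quadC ν P K * M = 0) (hz : IsAway E z)
    (hq : (quadA P K).eval z ≠ 0) :
    cauchyTransform ν (P 0) z ^ 2 * M.eval z = N.eval z := by
  have h1 := H.quadratic D hz
  have h2 := congrArg (eval z) hAC
  rw [hB] at h1
  simp only [eval_add, eval_mul, eval_zero] at h1 h2
  refine mul_left_cancel₀ hq ?_
  linear_combination M.eval z * h1 - h2

end IsOrthogonalSystem

/-! ### Signs inside a gap and the shift of zeros. -/

section GapZeros

open Filter Topology

namespace IsOrthogonalSystem

variable {ν : Measure ℝ} {E : Set ℝ} {P : ℕ → ℝ[X]} {a b z : ℝ}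

lemma isAway_of_mem_gap (hgap : Disjoint E (Set.Ioo a b)) (hz : z ∈ Set.Ioo a b) : IsAway E z := by
  refine ⟨min (z - a) (b - z), lt_min (by linarith [hz.1]) (by linarith [hz.2]), fun x hx => ?_⟩
  have hx' : x ≤ a ∨ b ≤ x := by
    by_contra! h
    exact Set.disjoint_left.1 hgap hx h
  rcases hx' with h | h
  · exact (min_le_left _ _).trans ((by linarith : z - a ≤ z - x).trans (le_abs_self _))
  · exact (min_le_right _ _).trans ((by linarith : b - z ≤ -(z - x)).trans (neg_le_abs _))

lemma gap_mul_pos (hgap : Disjoint E (Set.Ioo a b)) {y x : ℝ} (hz : z ∈ Set.Ioo a b)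
    (hy : y ∈ Set.Ioc a b) (hx : x ∈ E) : 0 ≤ (x - z) * (x - y) := by
  have hx' : x ≤ a ∨ b ≤ x := by
    by_contra! h
    exact Set.disjoint_left.1 hgap hx h
  rcases hx' with h | h
  · exact mul_nonneg_of_nonpos_of_nonpos (by linarith [hz.1]) (by linarith [hy.1])
  · exact mul_nonneg (by linarith [hz.2]) (by linarith [hy.2])

variable [IsFiniteMeasure ν]

lemma continuousOn_cauchy (H : IsOrthogonalSystem ν E P) (hgap : Disjoint E (Set.Ioo a b))
    (p : ℝ[X]) : ContinuousOn (cauchyTransform ν p) (Set.Ioo a b) := by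
  intro z hz
  obtain ⟨δ, hδ, hd⟩ := isAway_of_mem_gap hgap hz
  refine (continuousAt_of_dominated (F := fun z x => p.eval x * (z - x)⁻¹)
    (bound := fun x => |p.eval x| * (δ / 2)⁻¹) ?_ ?_ ?_ ?_).continuousWithinAt
  · exact .of_forall fun w => (p.continuous.aestronglyMeasurable).mul
      (by fun_prop : Measurable fun x => (w - x)⁻¹).aestronglyMeasurable
  · filter_upwards [Metric.ball_mem_nhds z (half_pos hδ)] with w hw
    filter_upwards [H.carrier] with x hx
    rw [norm_mul, norm_inv, Real.norm_eq_abs, Real.norm_eq_abs]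
    refine mul_le_mul_of_nonneg_left (inv_anti₀ (half_pos hδ) ?_) (abs_nonneg _)
    have h1 := hd x hx
    have h2 : |w - z| < δ / 2 := hw
    have h3 := abs_sub_le z w x
    rw [abs_sub_comm z w] at h3
    linarith
  · exact (integrable_eval H.carrier H.subset p).abs.mul_const _
  · filter_upwards [H.carrier] with x hx
    have : z - x ≠ 0 := (isAway_of_mem_gap hgap hz).sub_ne_zero hx
    exact continuousAt_const.mul ((continuousAt_id.sub continuousAt_const).inv₀ this)

/-- `Pₙ ψₙ` is strictly decreasing on a gap. -/
lemma eval_mul_cauchy_strictAnti (H : IsOrthogonalSystem ν E P) (hgap : Disjoint E (Set.Ioo a b))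
    (n : ℕ) : StrictAntiOn (fun z => (P n).eval z * cauchyTransform ν (P n) z) (Set.Ioo a b) := by
  intro z hz y hy hzy
  have hza := isAway_of_mem_gap hgap hz
  have hya := isAway_of_mem_gap hgap hy
  have hp := integrable_eval H.carrier H.subset (P n ^ 2)
  simp only [eval_pow] at hp
  have i1 := integrable_mul_inv H.carrier hza hp
  have i2 := integrable_mul_inv H.carrier hya hp
  simp only [H.eval_mul_cauchy hza, H.eval_mul_cauchy hya]
  rw [← sub_pos, ← integral_sub i1 i2]
  have key : ∀ x ∈ E, (P n).eval x ^ 2 * (z - x)⁻¹ - (P n).eval x ^ 2 * (y - x)⁻¹ =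
      (P n).eval x ^ 2 * ((y - z) / ((x - z) * (x - y))) ∧ 0 < (x - z) * (x - y) := by
    intro x hx
    have h1 := hza.sub_ne_zero hx
    have h2 := hya.sub_ne_zero hx
    have h3 : x - z ≠ 0 := by rw [← neg_sub]; exact neg_ne_zero.2 h1
    have h4 : x - y ≠ 0 := by rw [← neg_sub]; exact neg_ne_zero.2 h2
    refine ⟨?_, lt_of_le_of_ne (gap_mul_pos hgap hz ⟨hy.1, hy.2.le⟩ hx) (mul_ne_zero h3 h4).symm⟩
    rw [show (x - z) * (x - y) = (z - x) * (y - x) by ring]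
    field_simp
    ring
  refine integral_pos_of_zeros H.ne_zero H.atomless (i1.sub i2) ?_ (H.monic n).ne_zero ?_
  · filter_upwards [H.carrier] with x hx
    rw [(key x hx).1]
    have := (key x hx).2
    have := sub_pos.2 hzy
    positivity
  · filter_upwards [H.carrier] with x hx h0
    rw [(key x hx).1] at h0
    have h1 : (y - z) / ((x - z) * (x - y)) ≠ 0 :=
      (div_pos (sub_pos.2 hzy) (key x hx).2).ne'
    exact pow_eq_zero_iff two_ne_zero |>.1 ((mul_eq_zero.1 h0).resolve_right h1)

/-- Pₙψₙ is injective on the gap and already vanishes at y, so a zero of ψₙ could only be y itself;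
the Wronskian forbids a common zero. -/
lemma cauchy_ne_zero_of_eval_eq_zero (H : IsOrthogonalSystem ν E P)
    (hgap : Disjoint E (Set.Ioo a b)) {n : ℕ} {y : ℝ} (hy : y ∈ Set.Ioo a b)
    (hy0 : (P n).eval y = 0) (hz : z ∈ Set.Ioo a b) : cauchyTransform ν (P n) z ≠ 0 := by
  intro h
  have hanti := (H.eval_mul_cauchy_strictAnti hgap n).injOn hz hy (by simp [h, hy0])
  subst hanti
  have h1 := H.wronskian (isAway_of_mem_gap hgap hz) n
  rw [h, hy0] at h1
  linarith [H.norm_pos n]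

/-- A polynomial `Pₙ` with a zero in a gap does not vanish at the right end of the gap. -/
lemma eval_right_ne_zero (H : IsOrthogonalSystem ν E P) (hgap : Disjoint E (Set.Ioo a b)) {n : ℕ}
    {y : ℝ} (hy : y ∈ Set.Ioo a b) (hy0 : (P n).eval y = 0) : (P n).eval b ≠ 0 := by
  intro hb
  obtain ⟨R₁, hR₁⟩ := dvd_iff_isRoot.2 hy0
  have h1 : R₁.IsRoot b := by
    have h2 := congrArg (eval b) hR₁
    rw [hb, eval_mul] at h2
    have h3 : eval b (X - C y) ≠ 0 := by simp; linarith [hy.2]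
    exact (mul_eq_zero.1 h2.symm).resolve_left h3
  -- Now Pₙ = (x - y)(x - b)R, so PₙR = (x - y)(x - b)R² ≥ 0 on E, contradicting orthogonality of Pₙ
  -- to R.
  obtain ⟨R, rfl⟩ := dvd_iff_isRoot.2 h1
  have hP0 := (H.monic n).ne_zero
  have hR0 : R ≠ 0 := by rintro rfl; simp at hR₁; exact hP0 hR₁
  have hdeg : R.degree < n := by
    rw [← H.degree_eq n, hR₁, degree_mul, degree_mul, degree_X_sub_C, degree_X_sub_C,
      degree_eq_natDegree hR0]
    norm_cast
    omega
  have hz := H.pairing_eq_zero n R hdeg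
  have hi := integrable_eval H.carrier H.subset (P n * R)
  simp only [eval_mul] at hi
  refine (integral_pos_of_zeros H.ne_zero H.atomless hi ?_ hP0 ?_).ne' hz
  · filter_upwards [H.carrier] with x hx
    have h4 := gap_mul_pos hgap hy ⟨hy.1.trans hy.2, le_rfl⟩ hx
    have h5 : (P n).eval x * R.eval x = ((x - y) * (x - b)) * R.eval x ^ 2 := by
      rw [hR₁]; simp; ring
    rw [h5]
    exact mul_nonneg h4 (sq_nonneg _)
  · refine .of_forall fun x h0 => ?_
    rcases mul_eq_zero.1 h0 with h | h
    · exact h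
    · rw [hR₁]; simp [h]

/-- If `F² M = N` near both ends of a gap and `N` vanishes at the left end while `M` does not,
then `F < 0` on the gap. -/
lemma cauchy_neg (H : IsOrthogonalSystem ν E P) (hgap : Disjoint E (Set.Ioo a b)) {N M q : ℝ[X]}
    (hq : q ≠ 0) (hF : ∀ z ∈ Set.Ioo a b, q.eval z ≠ 0 →
      cauchyTransform ν (P 0) z ^ 2 * M.eval z = N.eval z)
    (hN : N.eval a = 0) (hM : M.eval a ≠ 0) (hz : z ∈ Set.Ioo a b) :
    cauchyTransform ν (P 0) z < 0 := by
  by_contra! h0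
  have hanti : StrictAntiOn (cauchyTransform ν (P 0)) (Set.Ioo a b) := by
    have := H.eval_mul_cauchy_strictAnti hgap 0
    simpa [H.apply_zero] using this
  obtain ⟨w, hw1, hw2⟩ := exists_between hz.1
  have hw : w ∈ Set.Ioo a b := ⟨hw1, hw2.trans hz.2⟩
  have hc := h0.trans_lt (hanti hw hz hw2)
  set c := cauchyTransform ν (P 0) w
  -- F is decreasing, so F ≥ c > 0 to the left of w; then F² = N/M stays above c² as x → a, although
  -- N(a) = 0 and M(a) ≠ 0.
  have h1 : ∀ᶠ x in 𝓝[>] a, c ^ 2 * |M.eval x| ≤ |N.eval x| := by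
    filter_upwards [Ioo_mem_nhdsGT hw1,
      nhdsWithin_mono a (fun x hx => ne_of_gt hx) (eventually_eval_ne_zero hq a)] with x hx hqx
    have hx' : x ∈ Set.Ioo a b := ⟨hx.1, hx.2.trans hw.2⟩
    rw [← hF x hx' hqx, abs_mul, abs_of_nonneg (sq_nonneg (cauchyTransform ν (P 0) x))]
    exact mul_le_mul_of_nonneg_right
      (pow_le_pow_left₀ hc.le (hanti hx' hw hx.2).le 2) (abs_nonneg _)
  have h2 : c ^ 2 * |M.eval a| ≤ |N.eval a| :=
    le_of_tendsto_of_tendsto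
      ((continuous_const.mul M.continuous.abs).continuousWithinAt (s := Set.Ioi a)).tendsto
      (N.continuous.abs.continuousWithinAt (s := Set.Ioi a)).tendsto h1
  rw [hN, abs_zero] at h2
  have := abs_pos.2 hM
  have : 0 < c ^ 2 * |M.eval a| := by positivity
  linarith

variable {K : ℕ} {A : ℝ}

/-- Zeros in a gap survive a shift by the period, when `F = √(N / M)` with `N` vanishing at the
left end of the gap and `M` at the right end. -/
theorem exists_zero_shift (H : IsOrthogonalSystem ν E P)
    (D : IsPeriodicData (sqNorm ν P) (diagCoeff ν P) K A) {N M : ℝ[X]} (hN1 : N.eval 1 ≠ 0)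
    (hM1 : M.eval 1 ≠ 0)
    (hF : ∀ z, 1 < z → cauchyTransform ν (P 0) z ^ 2 * ((X - C 1) * M).eval z = N.eval z)
    (hgap : Disjoint E (Set.Ioo a b)) (hNa : N.eval a = 0) (hMa : ((X - C 1) * M).eval a ≠ 0)
    (hNb : N.eval b ≠ 0) (hMb : ((X - C 1) * M).eval b = 0) {n : ℕ}
    (hzero : ∃ y ∈ Set.Ioo a b, (P n).eval y = 0) :
    ∃ y ∈ Set.Ioo a b, (P (n + K)).eval y = 0 := by
  obtain ⟨y, hy, hy0⟩ := hzero
  have hn : 1 ≤ n := by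
    rcases Nat.eq_zero_or_pos n with rfl | h
    · simp [H.apply_zero] at hy0
    · exact h
  obtain ⟨hAC, hB⟩ := H.quad_eq_zero D hN1 hM1 hF
  have hq := H.quadA_ne_zero D
  set L := (X - C 1) * M with hL
  have hFgap : ∀ z ∈ Set.Ioo a b, (quadA P K).eval z ≠ 0 →
      cauchyTransform ν (P 0) z ^ 2 * L.eval z = N.eval z := fun z hz =>
    H.eval_eq_of_quad D hB hAC (isAway_of_mem_gap hgap hz)
  have hneg : ∀ z ∈ Set.Ioo a b, cauchyTransform ν (P 0) z < 0 := fun z hz =>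
    H.cauchy_neg hgap hq hFgap hNa hMa hz
  have hcmp := fun z (hz : z ∈ Set.Ioo a b) =>
    H.shift_comparison D hB (isAway_of_mem_gap hgap hz) (hneg z hz) hn
  have hψ : ∀ z ∈ Set.Ioo a b, cauchyTransform ν (P (n + K)) z ≠ 0 := by
    intro z hz
    obtain ⟨l, hl0, -, hl⟩ := H.exists_cauchy_multiplier D (isAway_of_mem_gap hgap hz)
    rw [hl n hn]
    exact mul_ne_zero hl0 (H.cauchy_ne_zero_of_eval_eq_zero hgap hy hy0 hz)
  -- Multiplying the exact scaling of P²F² - Q² by L gives a relation between P²N - Q²L at n + K and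
  -- at n that extends continuously to b, where L vanishes and only P²N survives.
  have hPb : (P (n + K)).eval b ≠ 0 := by
    have h1 : ∀ᶠ x in 𝓝[<] b, ((P (n + K)).eval x ^ 2 * N.eval x -
        (secondKind ν P (n + K)).eval x ^ 2 * L.eval x) =
        A * ((P n).eval x ^ 2 * N.eval x - (secondKind ν P n).eval x ^ 2 * L.eval x) := by
      filter_upwards [Ioo_mem_nhdsLT (hy.1.trans hy.2),
        nhdsWithin_mono b (fun x hx => ne_of_lt hx) (eventually_eval_ne_zero hq b)] with x hx hqx
      rw [← hFgap x hx hqx]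
      linear_combination L.eval x * (hcmp x hx).2
    have h2 := tendsto_nhds_unique_of_eventuallyEq
      ((by fun_prop : Continuous fun x => (P (n + K)).eval x ^ 2 * N.eval x -
        (secondKind ν P (n + K)).eval x ^ 2 * L.eval x).continuousWithinAt
          (s := Set.Iio b) (x := b)).tendsto
      ((by fun_prop : Continuous fun x => A * ((P n).eval x ^ 2 * N.eval x -
        (secondKind ν P n).eval x ^ 2 * L.eval x)).continuousWithinAt
          (s := Set.Iio b) (x := b)).tendsto h1
    intro h3
    rw [h3, hMb] at h2
    have h4 : A * ((P n).eval b ^ 2 * N.eval b) ≠ 0 :=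
      mul_ne_zero D.factor_pos.ne'
        (mul_ne_zero (pow_ne_zero 2 (H.eval_right_ne_zero hgap hy hy0)) hNb)
    apply h4
    linarith
  obtain ⟨c, hc1, hc2⟩ := exists_between hy.1
  have hc : c ∈ Set.Ioo a b := ⟨hc1, hc2.trans hy.2⟩
  have hGc : 0 < (P (n + K)).eval c * cauchyTransform ν (P (n + K)) c := by
    have h1 := H.eval_mul_cauchy_strictAnti hgap n hc hy hc2
    simp only [hy0, zero_mul] at h1
    exact (mul_pos D.factor_pos h1).trans_le (hcmp c hc).1
  -- As L(b) = 0 while P²N is nonzero at b, close to b one has Q² < P²F², so P(PF - Q) has the sign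
  -- of F. The point d also avoids the zeros of `quadA`, where F²L = N is not available.
  obtain ⟨d, ⟨hd1, hd2⟩, hdq, hd⟩ : ∃ d, (y < d ∧ d < b) ∧ (quadA P K).eval d ≠ 0 ∧
      (secondKind ν P (n + K)).eval d ^ 2 * |L.eval d| <
        (P (n + K)).eval d ^ 2 * |N.eval d| := by
    have h1 : ∀ᶠ x in 𝓝[<] b, (secondKind ν P (n + K)).eval x ^ 2 * |L.eval x| <
        (P (n + K)).eval x ^ 2 * |N.eval x| := by
      refine nhdsWithin_le_nhds (Continuous.continuousAt (by fun_prop) |>.eventually_lt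
        (Continuous.continuousAt (by fun_prop)) ?_)
      rw [hMb, abs_zero, mul_zero]
      have := abs_pos.2 hNb
      positivity
    have h2 := (h1.and (nhdsWithin_mono b (fun x hx => ne_of_lt hx)
      (eventually_eval_ne_zero hq b))).and (Ioo_mem_nhdsLT hy.2)
    obtain ⟨d, ⟨h3, h4⟩, h5⟩ := h2.exists
    exact ⟨d, h5, h4, h3⟩
  have hdm : d ∈ Set.Ioo a b := ⟨hy.1.trans hd1, hd2⟩
  have hGd : (P (n + K)).eval d * cauchyTransform ν (P (n + K)) d < 0 := by
    have hFd := hneg d hdm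
    rw [← hFgap d hdm hdq, abs_mul, abs_of_nonneg (sq_nonneg (cauchyTransform ν (P 0) d)),
      ← mul_assoc] at hd
    rw [H.cauchy_eq (isAway_of_mem_gap hgap hdm)]
    set F := cauchyTransform ν (P 0) d
    set p := (P (n + K)).eval d
    set s := (secondKind ν P (n + K)).eval d
    have h1 : s ^ 2 < (p * F) ^ 2 := by
      rw [mul_pow]
      exact lt_of_mul_lt_mul_right hd (abs_nonneg _)
    have h2 := sq_lt_sq.1 h1
    have h3 : p ≠ 0 := by
      intro h
      rw [h, zero_mul, abs_zero] at h2
      exact absurd h2 (not_lt.2 (abs_nonneg _))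
    have h4 : -(p * s) ≤ |p| * |s| := by rw [← abs_mul]; exact neg_le_abs _
    have h5 : |p| * |s| < |p| * |p * F| := mul_lt_mul_of_pos_left h2 (abs_pos.2 h3)
    rw [abs_mul p F, ← mul_assoc, abs_mul_abs_self, abs_of_neg hFd] at h5
    linarith
  have hcd : c ≤ d := (hc2.trans hd1).le
  have hsub : Set.Icc c d ⊆ Set.Ioo a b := fun x hx => ⟨hc.1.trans_le hx.1, hx.2.trans_lt hd2⟩
  have hsign : 0 < cauchyTransform ν (P (n + K)) c * cauchyTransform ν (P (n + K)) d := by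
    refine lt_of_le_of_ne (not_lt.1 fun h => ?_) (mul_ne_zero (hψ c hc) (hψ d hdm)).symm
    obtain ⟨x, hx, hx0⟩ := exists_zero_of_mul_neg hcd
      ((H.continuousOn_cauchy hgap (P (n + K))).mono hsub) h
    exact hψ x (hsub (Set.Ioo_subset_Icc_self hx)) hx0
  have hPcd : (P (n + K)).eval c * (P (n + K)).eval d < 0 := by
    have h1 := mul_neg_of_pos_of_neg hGc hGd
    by_contra! h2
    have h3 := mul_nonneg h2 hsign.le
    linarith
  obtain ⟨x, hx, hx0⟩ := exists_zero_of_mul_neg hcd (P (n + K)).continuousOn hPcd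
  exact ⟨x, hsub (Set.Ioo_subset_Icc_self hx), hx0⟩

end IsOrthogonalSystem

/-! ### Application to the band measure. -/

namespace GenCheb

variable {g : ℕ} {α β : Fin g → ℝ}

/-- Since aₙ₊₁ = hₙ₊₁/hₙ is periodic for n ≥ 1, the ratio of hₙ₊ₖ (shift by K) to hₙ is constant
from n = 1 on, hence equal to its value at 1. -/
lemma isPeriodicData (hα : ∀ i, -1 < α i) (hαβ : ∀ i, α i ≤ β i) (hβ : ∀ i, β i < 1)
    (hord : ∀ i j, i < j → β i < α j) {K : ℕ} (hK : 1 ≤ K) (hper : HasPeriod α β K) :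
    IsPeriodicData (IsOrthogonalSystem.sqNorm (bandMeasure α β) (P α β))
      (IsOrthogonalSystem.diagCoeff (bandMeasure α β) (P α β)) K (h α β (1 + K) / h α β 1) := by
  have H := isOrthogonalSystem hα hαβ hβ hord
  have := isFiniteMeasure_bandMeasure (weight_integral hα hαβ hβ hord).1
  have hpos : ∀ n, 0 < h α β n := fun n => by rw [h_eq]; exact H.norm_pos n
  refine ⟨H.norm_pos, fun n => ?_, fun n hn => ?_, hK⟩
  · have h1 := hper.1 (n + 1) (by omega)
    simp only [recB, show n + 1 + K - 1 = n + K by omega, Nat.add_sub_cancel] at h1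
    simpa only [IsOrthogonalSystem.diagCoeff, pairing_bandMeasure, h] using h1
  · simp only [IsOrthogonalSystem.sqNorm, ← h_eq]
    induction n, hn using Nat.le_induction with
    | base => have := (hpos 1).ne'; field_simp
    | succ n hn ih =>
      have h1 := hper.2 (n + 1) (by omega)
      simp only [recA, show n + 1 + K - 1 = n + K by omega, Nat.add_sub_cancel] at h1
      rw [div_eq_div_iff (hpos _).ne' (hpos _).ne', ih] at h1
      refine mul_right_cancel₀ (hpos n).ne' ?_
      rw [h1]
      ring

lemma cauchyTransform_bandMeasure (z : ℝ) : cauchyTransform (bandMeasure α β) (P α β 0) z =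
    ∫ x in bands α β, weight α β x * (z - x)⁻¹ := by
  have : P α β 0 = 1 := by rw [P]; simp
  rw [cauchyTransform, integral_bandMeasure, this]
  simp

theorem exists_zero_add_period (hα : ∀ i, -1 < α i) (hαβ : ∀ i, α i ≤ β i) (hβ : ∀ i, β i < 1)
    (hord : ∀ i j, i < j → β i < α j) {K : ℕ} (hK : 1 ≤ K) (hper : HasPeriod α β K)
    {j : ℕ} {i : Fin g} (hzero : ∃ x ∈ Set.Ioo (α i) (β i), (P α β j).eval x = 0) :
    ∃ y ∈ Set.Ioo (α i) (β i), (P α β (j + K)).eval y = 0 := by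
  have hint := weight_integral hα hαβ hβ hord
  have := isFiniteMeasure_bandMeasure hint.1
  have hi : α i < β i := by
    obtain ⟨x, hx, -⟩ := hzero
    exact hx.1.trans hx.2
  refine (isOrthogonalSystem hα hαβ hβ hord).exists_zero_shift
    (isPeriodicData hα hαβ hβ hord hK hper) (N := ∏ k, (X - C (α k)))
    (M := (X + C 1) * ∏ k, (X - C (β k))) ?_ ?_ ?_ ?_ ?_ ?_ ?_ ?_ hzero
  · simp only [eval_prod, eval_sub, eval_X, eval_C]
    exact Finset.prod_ne_zero_iff.2 fun k _ => by linarith [hαβ k, hβ k]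
  · simp only [eval_mul, eval_add, eval_prod, eval_sub, eval_X, eval_C]
    exact mul_ne_zero (by norm_num)
      (Finset.prod_ne_zero_iff.2 fun k _ => by linarith [hβ k])
  · intro z hz
    rw [cauchyTransform_bandMeasure, hint.2.2 z hz]
    simp only [eval_mul, eval_add, eval_prod, eval_sub, eval_X, eval_C]
    have h1 : ∏ k, (z - β k) ≠ 0 := Finset.prod_ne_zero_iff.2 fun k _ => by linarith [hβ k]
    have h2 : z ^ 2 - 1 ≠ 0 := by nlinarith
    rw [← mul_assoc (z - 1), show (z - 1) * (z + 1) = z ^ 2 - 1 by ring]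
    field_simp
  · refine Set.disjoint_left.2 fun x hx hx' => hx.2 (Set.mem_iUnion.2 ⟨i, hx'⟩)
  · simp only [eval_prod, eval_sub, eval_X, eval_C]
    exact Finset.prod_eq_zero (Finset.mem_univ i) (sub_self _)
  · simp only [eval_mul, eval_add, eval_prod, eval_sub, eval_X, eval_C]
    refine mul_ne_zero (by linarith [hβ i]) (mul_ne_zero (by linarith [hα i])
      (Finset.prod_ne_zero_iff.2 fun k _ => ?_))
    rcases lt_trichotomy k i with h | rfl | h
    · linarith [hord k i h]
    · linarith
    · linarith [hord i k h, hαβ k]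
  · simp only [eval_prod, eval_sub, eval_X, eval_C]
    refine Finset.prod_ne_zero_iff.2 fun k _ => ?_
    rcases lt_trichotomy k i with h | rfl | h
    · linarith [hord k i h, hαβ k]
    · linarith
    · linarith [hord i k h]
  · simp only [eval_mul, eval_add, eval_prod, eval_sub, eval_X, eval_C]
    rw [Finset.prod_eq_zero (Finset.mem_univ i) (sub_self _)]
    ring

end GenCheb

end GapZeros

theorem mainTheorem11 (g : ℕ) (α β : Fin g → ℝ)
    (hα : ∀ i, -1 < α i) (hαβ : ∀ i, α i ≤ β i) (hβ : ∀ i, β i < 1)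
    (hord : ∀ i j, i < j → β i < α j)
    (K : ℕ) (hK : 1 ≤ K) (hper : GenCheb.HasPeriod α β K)
    (n j : ℕ) (i : Fin g)
    (hzero : ∃ x ∈ Set.Ioo (α i) (β i), (GenCheb.P α β j).eval x = 0) :
    ∃ y ∈ Set.Ioo (α i) (β i), (GenCheb.P α β (n * K + j)).eval y = 0 := by
  induction n with
  | zero => simpa using hzero
  | succ n ih =>
    rw [show (n + 1) * K + j = n * K + j + K by ring]
    exact GenCheb.exists_zero_add_period hα hαβ hβ hord hK hper ih
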